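/- **Setting.** Let $\kappa$ be the security parameter, and count memory in words of $\kappa$ bits. The cylinder graph $\Pi^C_h$ has $n=2h^2$ vertices $v_i^j$ ($0\le i<2h$, $j\in\mathbb Z/h$) and the edges $(v_i^j,v_{i+1}^j)$ and $(v_i^j,v_{i+1}^{j+1})$ for $0\le i\le 2h-2$. Let $h=h(\kappa)$ be such that $n=n(\kappa)$ is bounded above and below by positive powers of $\kappa$ for all large $\kappa$. A random oracle $\mathcal O$ answers, with $\kappa$-bit strings, labeling queries $(v,\ell_1,\dots,\ell_d)$, where $v$ is a vertex, $d\in\{1,2\}$ and $\ell_i\in\{0,1\}^\kappa$, and (separately) queries $x\in\{0,1\}^\kappa$. Fix any input label $\zeta=\zeta(\kappa)\in\{0,1\}^\kappa$. The label of a source $v$ is $\mathcal O(v,\zeta)$; the label of any other vertex $v$ is $\mathcal O(v,\text{labels of the predecessors of }v)$, the predecessors being taken in lexicographic order of vertices. **The hash function.** ${\cal H}_1$ outputs the string $R^*$ of the $h$ labels of the sinks of $\Pi^C_h$. ${\cal H}_2$, on input $x\in\{0,1\}^\kappa$, queries $\rho_0=\mathcal O(x)$ and $\rho_1=\mathcal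 O(x+1)$ (addition modulo $2^\kappa$), lets $\iota=\rho_0 \bmod h$, looks up the $\iota$-th word $y'$ of $R^*$ (a single lookup, words counted from $0$), and outputs $h_\kappa(x)=y'\oplus\rho_1$. **Hardness.** An algorithm in the parallel random oracle model works in iterations. Each iteration receives a state (a bit string; the first one is the input), makes one batch of parallel oracle queries depending on that state and the coins, and then, from the state and the answers, computes the next state, possibly appends values to a write-only output register, and possibly terminates. The family $\{h_\kappa\}$ is *$(\Lambda,\tau,q)$-hard* if the following holds for every $\Delta=\Delta(\kappa)\in\omega(\log\kappa)$, every static string $R$ of $\lfloor\kappa\Lambda-\Delta\rfloor$ bits (empty if this is negative; $R$ may even depend on $\mathcal O$), every, possibly non-uniform, probabilistic algorithm ${\cal A}$ whose numbers of iterations and of oracle queries are polynomially bounded in $\kappa+(\text{input length})$ (in particular every PPT algorithm), and every set $X=\{x_1,\dots,x_q\}\subseteq\{0,1\}^\kappa$ of $q=q(\kappa)$ inputs fixed independently of $\mathcal O$: the probability, over $\mathcal O$ and the coins of ${\cal A}$, that ${\cal A}(1^\kappa,R)$ outputs exactly $\{(x_1,h_\kappa(x_1)),\dots,(x_q,h_\kappa(x_q))\}$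 while fewer than $\tau$ of its states have size at least $\Lambda$ words is negligible in $\kappa$. **Theorem.** There is a function $\tau(n)\in\Theta(\sqrt n)$ such that, for all $h$ and $\zeta$ as above, for every constant $\lambda\ge 0$, every $\Lambda=\Lambda(\kappa)\ge 0$ with $\Lambda\in\Theta(\sqrt n)$ and $$\frac{\bigl(h-(\Lambda-\lambda)\bigr)\,\kappa}{h\log\kappa}\longrightarrow\infty\qquad(\kappa\to\infty),$$ and every $q=q(\kappa)\in\omega(\Lambda\log\Lambda)$, the family $\{h_\kappa\}$ is $(\Lambda-\lambda,\ \tau(n),\ q)$-hard. (The displayed condition holds, for instance, whenever $\Lambda\le(1-\varepsilon)h$ for some fixed $\varepsilon>0$; it says that the memory threshold stays slightly below the $h$ words that suffice to store the whole output of ${\cal H}_1$.) -/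

import Mathlib

open Filter Asymptotics Topology

noncomputable section

/-! ### Labelings of directed acyclic graphs -/

/-- A finite directed acyclic graph on a linearly ordered vertex set, all in-degrees being at most
`δ`. (On a finite vertex set, well-foundedness of the edge relation is acyclicity.) -/
structure BoundedDAG (V : Type) [Fintype V] [LinearOrder V] (δ : ℕ) where
  Adj : V → V → Prop
  decAdj : DecidableRel Adj
  acyclic : WellFounded Adj
  indeg_le : ∀ v, (Finset.univ.filter fun u => Adj u v).card ≤ δ

namespace BoundedDAG

variable {V : Type} [Fintype V] [LinearOrder V] {δ : ℕ}

attribute [instance] BoundedDAG.decAdj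

/-- The direct predecessors of `v`, in increasing order of vertices. -/
def pred (G : BoundedDAG V δ) (v : V) : List V :=
  (Finset.univ.filter fun u => G.Adj u v).sort (· ≤ ·)

/-- The sinks, in increasing order of vertices. -/
def sinks (G : BoundedDAG V δ) : List V :=
  (Finset.univ.filter fun v => ∀ w, ¬ G.Adj v w).sort (· ≤ ·)

theorem mem_pred (G : BoundedDAG V δ) {u v : V} : u ∈ G.pred v ↔ G.Adj u v := by
  simp [pred]

theorem length_pred_le (G : BoundedDAG V δ) (v : V) : (G.pred v).length ≤ δ := by
  simpa [pred] using G.indeg_le v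

end BoundedDAG

/-- Labeling queries `(v, (ℓ₁, …, ℓ_d))`: a vertex together with a tuple of `d` labels,
`1 ≤ d ≤ δ` (the component `d : Fin δ` is the number of labels minus one). -/
abbrev LabelQuery (V : Type) (δ : ℕ) (L : Type) : Type :=
  V × (Σ d : Fin δ, (Fin (d.val + 1) → L))

namespace BoundedDAG

variable {V : Type} [Fintype V] [LinearOrder V] {δ : ℕ}

/-- The `(O, ζ)`-labeling: a source `v` gets the label `O(v, ζ)`, every other vertex `v` gets
the label `O(v, labels of the predecessors of v)`. -/
def label [NeZero δ] {L : Type} (G : BoundedDAG V δ) (O : LabelQuery V δ L → L) (ζ : L)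
    (v : V) : L :=
  if hv : G.pred v = [] then
    O (v, ⟨0, fun _ => ζ⟩)
  else
    have hpos : 0 < (G.pred v).length := List.length_pos_of_ne_nil hv
    have hle : (G.pred v).length ≤ δ := G.length_pred_le v
    O (v, ⟨⟨(G.pred v).length - 1, by omega⟩, fun k =>
      have hk : k.val < (G.pred v).length := by
        have := k.isLt
        simp only at this
        omega
      label G O ζ ((G.pred v)[k.val]'hk)⟩)
termination_by G.acyclic.wrap v
decreasing_by
  exact G.mem_pred.1 (List.getElem_mem hk)

/-- The graph function `ζ ↦ label(sinks)` of a graph. -/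
def graphFunction [NeZero δ] {L : Type} (G : BoundedDAG V δ) (O : LabelQuery V δ L → L) (ζ : L) :
    List L :=
  G.sinks.map (G.label O ζ)

end BoundedDAG

/-! ### The cylinder graph -/

/-- `2h` levels of `h` vertices each; `(i, j)` is the `j`-th vertex of level `i`. Vertices are
ordered lexicographically. -/
abbrev CylinderVertex (h : ℕ) : Type := Fin (2 * h) ×ₗ Fin h

/-- The edges of the cylinder: the `j`-th vertex of a level points to the `j`-th and to the
`(j+1 mod h)`-th vertex of the next level. -/
def cylinderAdj (h : ℕ) (u v : CylinderVertex h) : Prop :=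
  (ofLex v).1.val = (ofLex u).1.val + 1 ∧
    ((ofLex v).2.val = (ofLex u).2.val ∨ (ofLex v).2.val = ((ofLex u).2.val + 1) % h)

instance (h : ℕ) : DecidableRel (cylinderAdj h) := fun u v => by
  unfold cylinderAdj; infer_instance

theorem cylinderAdj_wf (h : ℕ) : WellFounded (cylinderAdj h) :=
  Subrelation.wf (r := InvImage (· < ·) fun v : CylinderVertex h => (ofLex v).1.val)
    (fun {u v} huv => by
      have := huv.1
      simp only [InvImage]
      omega)
    (InvImage.wf _ Nat.lt_wfRel.wf)

theorem cylinder_indeg_le (h : ℕ) (v : CylinderVertex h) :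
    (Finset.univ.filter fun u => cylinderAdj h u v).card ≤ 2 := by
  have hh : 0 < h := by have := (ofLex v).2.isLt; omega
  let f : CylinderVertex h → ℕ := fun u => (ofLex u).2.val
  have hmaps : ∀ u ∈ Finset.univ.filter (fun u => cylinderAdj h u v),
      f u ∈ ({(ofLex v).2.val, ((ofLex v).2.val + h - 1) % h} : Finset ℕ) := by
    intro u hu
    have h2 := ((Finset.mem_filter.1 hu).2).2
    have hb := (ofLex u).2.isLt
    rw [Finset.mem_insert, Finset.mem_singleton]
    change (ofLex u).2.val = _ ∨ (ofLex u).2.val = _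
    rcases h2 with h2 | h2
    · exact Or.inl h2.symm
    · right
      rcases Nat.lt_or_ge ((ofLex u).2.val + 1) h with hlt | hge
      · rw [Nat.mod_eq_of_lt hlt] at h2
        rw [h2, show (ofLex u).2.val + 1 + h - 1 = (ofLex u).2.val + h by omega,
          Nat.add_mod_right, Nat.mod_eq_of_lt hb]
      · have hbh : (ofLex u).2.val + 1 = h := by omega
        rw [hbh, Nat.mod_self] at h2
        rw [h2, Nat.mod_eq_of_lt (by omega)]
        omega
  refine le_trans (Finset.card_le_card_of_injOn f hmaps ?_) Finset.card_le_two
  intro u hu w hw huw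
  have h1 := ((Finset.mem_filter.1 hu).2).1
  have h2 := ((Finset.mem_filter.1 hw).2).1
  apply ofLex.injective
  refine Prod.ext (Fin.ext ?_) (Fin.ext huw)
  omega

/-- The cylinder graph of height `h`. -/
def cylinder (h : ℕ) : BoundedDAG (CylinderVertex h) 2 where
  Adj := cylinderAdj h
  decAdj := inferInstance
  acyclic := cylinderAdj_wf h
  indeg_le := cylinder_indeg_le h

/-- The number of vertices of the cylinder graph, `2h²`. -/
def cylinderSize (h : ℕ) : ℕ := Fintype.card (CylinderVertex h)

theorem cylinderSize_eq (h : ℕ) : cylinderSize h = 2 * h ^ 2 := by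
  have : Fintype.card (CylinderVertex h) = Fintype.card (Fin (2 * h) × Fin h) :=
    Fintype.card_congr ofLex
  rw [cylinderSize, this, Fintype.card_prod, Fintype.card_fin, Fintype.card_fin]
  ring

/-! ### Algorithms in the parallel random oracle model -/

/-- The result of one iteration: the state passed on to the next iteration, the values appended to
the output register, and whether the terminate symbol is appended. -/
structure IterationResult (Out : Type) where
  state : List Bool
  out : List Out
  halt : Bool

/-- An algorithm in the parallel random oracle model, with queries in `Dom`, oracle answers in
`Ans`, random coins in `Coins` and output values in `Out`. Iteration `i` computes from the state it
is given a batch of queries; all answers to the batch are received at once, and from the given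
state and the answers the result of the iteration is computed. -/
structure PROMAlgorithm (Dom Ans Coins Out : Type) where
  query : ℕ → Coins → List Bool → List Dom
  next : ℕ → Coins → List Bool → List Ans → IterationResult Out

/-- The situation between two iterations. -/
structure PROMConfig (Out : Type) where
  state : List Bool
  register : List Out
  halted : Bool

namespace PROMAlgorithm

variable {Dom Ans Coins Out : Type}

/-- The configuration reached after `i` iterations with oracle `O` and coins `ρ` on input `x`
(constant from the moment the algorithm has terminated). -/
def config (A : PROMAlgorithm Dom Ans Coins Out) (O : Dom → Ans) (ρ : Coins) (x : List Bool) :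
    ℕ → PROMConfig Out
  | 0 => ⟨x, [], false⟩
  | i + 1 =>
    let c := A.config O ρ x i
    if c.halted = true then c
    else
      let r := A.next i ρ c.state ((A.query i ρ c.state).map O)
      ⟨r.state, c.register ++ r.out, r.halt⟩

/-- The algorithm terminates, with the list `y` in its output register. -/
def Outputs (A : PROMAlgorithm Dom Ans Coins Out) (O : Dom → Ans) (ρ : Coins) (x : List Bool)
    (y : List Out) : Prop :=
  ∃ i, (A.config O ρ x i).halted = true ∧ (A.config O ρ x i).register = y

/-- Sustained memory: the number of states, passed on by one iteration to the next (the input being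
the first one), whose size in words of `w` bits is at least `Λ`. -/
def sustainedMem (w : ℕ) (Λ : ℝ) (A : PROMAlgorithm Dom Ans Coins Out) (O : Dom → Ans) (ρ : Coins)
    (x : List Bool) : ℕ∞ :=
  Set.encard {i : ℕ | (A.config O ρ x i).halted = false ∧
    Λ * w ≤ ((A.config O ρ x i).state.length : ℝ)}

end PROMAlgorithm

/-- A (non-uniform, probabilistic) family of algorithms whose number of iterations and number of
oracle queries per iteration are bounded by a polynomial in the security parameter plus the
input length. Local computation is not restricted; all probabilistic polynomial time algorithms
are covered. -/
def PolynomiallyBounded {Dom Ans Coins Out : ℕ → Type}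
    (A : ∀ κ, PROMAlgorithm (Dom κ) (Ans κ) (Coins κ) (Out κ)) : Prop :=
  ∃ p : Polynomial ℕ, ∀ (κ : ℕ) (O : Dom κ → Ans κ) (ρ : Coins κ) (x : List Bool),
    ((A κ).config O ρ x (p.eval (κ + x.length))).halted = true ∧
    ∀ i, ((A κ).config O ρ x i).halted = false →
      ((A κ).query i ρ ((A κ).config O ρ x i).state).length ≤ p.eval (κ + x.length)

/-! ### Static-memory hash functions -/

/-- A family of pairs `(H₁, H₂)`; the oracle for security parameter `κ` maps `Dom κ` to `κ`-bit
words. `H₁` outputs a string of `κ`-bit words, `H₂` gets the number of words of that string,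
access to its words through an oracle `Seek`, and a `κ`-bit input, and outputs a `κ`-bit word. -/
structure SHF (Dom : ℕ → Type) where
  H₁ : ∀ κ, (Dom κ → BitVec κ) → List (BitVec κ)
  H₂ : ∀ κ, (Dom κ → BitVec κ) → ℕ → (ℕ → BitVec κ) → BitVec κ → BitVec κ

/-- The oracle returning the `ι`-th word of `R` (counted from `0`). -/
def Seek {κ : ℕ} (R : List (BitVec κ)) (ι : ℕ) : BitVec κ := R.getD ι 0

namespace SHF

variable {Dom : ℕ → Type}

/-- The hash function `h_κ` with the random oracle `O`. -/
def hash (H : SHF Dom) (κ : ℕ) (O : Dom κ → BitVec κ) (x : BitVec κ) : BitVec κ :=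
  H.H₂ κ O (H.H₁ κ O).length (Seek (H.H₁ κ O)) x

/-- `(Λ, τ, q)`-hardness. `Λ` counts words of `κ` bits, `Δ` counts bits. For every
`Δ ∈ ω(log κ)`, every static string `R` of `Λ - Δ` memory (which may even depend on the random
oracle), every adversary `A`, and every choice of sets `X` of `q` inputs, the probability that `A`,
given `R`, outputs exactly the `q` pairs `(x, h(x))`, `x ∈ X`, while fewer than `τ` of its states
have size at least `Λ`, is negligible. The probability is over a uniformly random oracle and over
uniformly random coins. -/
def IsHard [∀ κ, Finite (Dom κ)] (H : SHF Dom) (Λ : ℕ → ℝ) (τ q : ℕ → ℕ) : Prop :=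
  ∀ (Δ : ℕ → ℕ), ((fun κ : ℕ => Real.log κ) =o[atTop] fun κ => (Δ κ : ℝ)) →
  ∀ (R : ∀ κ, (Dom κ → BitVec κ) → List Bool),
    (∀ᶠ κ in atTop, ∀ O, (R κ O).length = ⌊Λ κ * κ - Δ κ⌋₊) →
  ∀ (r : ℕ → ℕ)
    (A : ∀ κ, PROMAlgorithm (Dom κ) (BitVec κ) (Fin (r κ) → Bool) (BitVec κ × BitVec κ)),
    PolynomiallyBounded A →
  ∀ X : ∀ κ, Finset (BitVec κ), (∀ᶠ κ in atTop, (X κ).card = q κ) →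
  SuperpolynomialDecay atTop (fun κ : ℕ => (κ : ℝ)) fun κ : ℕ =>
    (Nat.card {ω : (Dom κ → BitVec κ) × (Fin (r κ) → Bool) //
        (∃ y, (A κ).Outputs ω.1 ω.2 (R κ ω.1) y ∧
          {p | p ∈ y} = (fun x => (x, H.hash κ ω.1 x)) '' (X κ : Set (BitVec κ))) ∧
        (A κ).sustainedMem κ (Λ κ) ω.1 ω.2 (R κ ω.1) < (τ κ : ℕ∞)} : ℝ) /
      (Nat.card ((Dom κ → BitVec κ) × (Fin (r κ) → Bool)) : ℝ)

end SHF

/-! ### The hash function built from the cylinder graph -/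

/-- The queries to the random oracle: labeling queries for the cylinder graph, and queries at
`κ`-bit strings. -/
abbrev CylinderQuery (h : ℕ → ℕ) (κ : ℕ) : Type :=
  LabelQuery (CylinderVertex (h κ)) 2 (BitVec κ) ⊕ BitVec κ

/-- The second algorithm, with a single lookup: from `ρ₀ = O(x)` the index `ι = ρ₀ mod |R|` is
obtained, and the output is `Seek(ι) ⊕ ρ₁` with `ρ₁ = O(x + 1)`. -/
def singleLookup {κ : ℕ} (O : BitVec κ → BitVec κ) (wlen : ℕ) (seek : ℕ → BitVec κ)
    (x : BitVec κ) : BitVec κ :=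
  let ρ₀ := O x
  let ρ₁ := O (x + 1)
  let ι := ρ₀.toNat % wlen
  seek ι ^^^ ρ₁

/-- `H₁` is the graph function of the cylinder graphs of heights `h κ`, at the input labels `ζ κ`;
`H₂` is the single-lookup algorithm. -/
def cylinderSHF (h : ℕ → ℕ) (ζ : ∀ κ, BitVec κ) : SHF (CylinderQuery h) where
  H₁ κ O := (cylinder (h κ)).graphFunction (fun z => O (Sum.inl z)) (ζ κ)
  H₂ _ O wlen seek x := singleLookup (fun z => O (Sum.inr z)) wlen seek x

end

/-!
Fix the coins and the part of the oracle answering the queries `x ∈ {0,1}^κ`, and let only the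
labeling part vary. A run is turned into a pebbling of the cylinder after the fact: a vertex is
*pebbled* at time `t` if from then on its label is used (as an argument of a correct query, or
through an output value) before its correct query is made. By this definition a vertex can only be
queried when its predecessors are pebbled, so the rules of parallel pebbling hold without any error
probability.

*Few bits, few pebbles* (`LabelingGame.card_le`). If `h` vertices are pebbled at a time `t`, then
the state at time `t` and, per pebbled vertex, a hint saying where its label first appears and where
it is first queried suffice to continue the run without asking the oracle for these `h` labels. So
overwriting the oracle by arbitrary values at the `h` correct queries is an injective operation
(`LabelingGame.overwrite_injective`), and such oracles are rare: a union bound over states of fewer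
than `T κ` bits and over hints gives probability at most `2 ^ (T κ + O(h log κ) - h κ)`. The
hypothesis on the memory threshold makes this negligible, hence states below the threshold come with
fewer than `h` pebbles.

*Many pebbles for a long time* (`exists_sustained_pebbles`). The input state is below the threshold,
so some column is free of pebbles, and its sink has to be pebbled from the sources. After the last
time at which a pebble-free path `Q` leads to that sink, pebbles climb `Q` only one level per step.
During the first `h` of these steps the part of `Q` above the pebbles is still long enough for `h`
disjoint paths from the sources to reach it (`le_ncard_of_forall_not_openPath`), each of which has
to carry a pebble. So there are `h` states with at least `h` pebbles, which are states above the
threshold, and `τ(n) = ⌊√(n / 2)⌋ = h` works.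

The outputs reveal the label of every sink as soon as every index below `h` is looked up for some
input in `X`. As `q` grows faster than `h log h`, this fails with negligible probability by the
coupon collector bound (`card_exists_residue_missed_le`).
-/

/-! ### Correct labeling queries -/

namespace BoundedDAG

variable {V : Type} [Fintype V] [LinearOrder V] {δ : ℕ} [NeZero δ] {L : Type}

/-- The correct query of the vertex `v`: the one whose answer is the label of `v`. -/
def labelQuery (G : BoundedDAG V δ) (O : LabelQuery V δ L → L) (ζ : L) (v : V) :
    LabelQuery V δ L :=
  if hv : G.pred v = [] then
    (v, ⟨0, fun _ => ζ⟩)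
  else
    have hpos : 0 < (G.pred v).length := List.length_pos_of_ne_nil hv
    have hle : (G.pred v).length ≤ δ := G.length_pred_le v
    (v, ⟨⟨(G.pred v).length - 1, by omega⟩, fun k =>
      have hk : k.val < (G.pred v).length := by
        have := k.isLt
        simp only at this
        omega
      G.label O ζ ((G.pred v)[k.val]'hk)⟩)

theorem label_eq (G : BoundedDAG V δ) (O : LabelQuery V δ L → L) (ζ : L) (v : V) :
    G.label O ζ v = O (G.labelQuery O ζ v) := by
  rw [label, labelQuery]
  split <;> rfl

theorem labelQuery_fst (G : BoundedDAG V δ) (O : LabelQuery V δ L → L) (ζ : L) (v : V) :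
    (G.labelQuery O ζ v).1 = v := by
  rw [labelQuery]
  split <;> rfl

theorem labelQuery_injective (G : BoundedDAG V δ) (O : LabelQuery V δ L → L) (ζ : L) :
    Function.Injective (G.labelQuery O ζ) := fun u v huv => by
  rw [← G.labelQuery_fst O ζ u, huv, labelQuery_fst]

theorem labelQuery_congr (G : BoundedDAG V δ) {O O' : LabelQuery V δ L → L} {ζ : L} {v : V}
    (h : ∀ u, G.Adj u v → G.label O ζ u = G.label O' ζ u) :
    G.labelQuery O ζ v = G.labelQuery O' ζ v := by
  unfold labelQuery
  split
  · rfl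
  · dsimp only
    congr 2
    funext k
    exact h _ (G.mem_pred.1 (List.getElem_mem _))

/-- The `k`-th label occurring in the `j`-th query of a batch, if there is one. -/
def labelAt {E : Type} (b : List (LabelQuery V δ L ⊕ E)) (j : ℕ) (k : ℕ) : Option L :=
  match b[j]? with
  | some (Sum.inl q) => if hk : k < q.2.1.val + 1 then some (q.2.2 ⟨k, hk⟩) else none
  | _ => none

theorem exists_labelAt {E : Type} (G : BoundedDAG V δ) (O : LabelQuery V δ L → L) (ζ : L)
    {u v : V} (huv : G.Adj u v) {b : List (LabelQuery V δ L ⊕ E)}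
    (hb : Sum.inl (G.labelQuery O ζ v) ∈ b) :
    ∃ j < b.length, ∃ k < δ, labelAt b j k = some (G.label O ζ u) := by
  obtain ⟨j, hj, hjv⟩ := List.getElem_of_mem hb
  obtain ⟨k, hk, hku⟩ := List.getElem_of_mem (G.mem_pred.2 huv)
  refine ⟨j, hj, k, hk.trans_le (G.length_pred_le v), ?_⟩
  have hv : G.pred v ≠ [] := List.ne_nil_of_mem (G.mem_pred.2 huv)
  have hbj : b[j]? = some (Sum.inl (G.labelQuery O ζ v)) := by
    rw [List.getElem?_eq_getElem hj, hjv]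
  rw [labelQuery, dif_neg hv] at hbj
  rw [labelAt, hbj]
  dsimp only
  rw [dif_pos (by omega)]
  simp only [hku]

end BoundedDAG

/-! ### Ex-post-facto pebbling of a run -/

/-- An algorithm together with everything that is fixed while the labeling part of the oracle
varies: the coins, the rest of the oracle, and rules `read v` by which the label of `v` may be read
off from values appended to the output register. The input may depend on the labeling oracle. -/
structure LabelingGame (V : Type) [Fintype V] [LinearOrder V] (δ : ℕ) (L E C Out : Type) where
  graph : BoundedDAG V δ
  inputLabel : L
  alg : PROMAlgorithm (LabelQuery V δ L ⊕ E) L C Out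
  sideOracle : E → L
  coins : C
  input : (LabelQuery V δ L → L) → List Bool
  read : V → List Out → Option L

namespace LabelingGame

variable {V : Type} [Fintype V] [LinearOrder V] {δ : ℕ} {L E C Out : Type}
variable (g : LabelingGame V δ L E C Out) (O : LabelQuery V δ L → L)

/-- The configuration after `i` iterations. -/
def config (i : ℕ) : PROMConfig Out :=
  g.alg.config (Sum.elim O g.sideOracle) g.coins (g.input O) i

/-- The queries of iteration `i` (none after termination). -/
def batch (i : ℕ) : List (LabelQuery V δ L ⊕ E) :=
  if (g.config O i).halted = true then [] else g.alg.query i g.coins (g.config O i).state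

/-- The values appended to the output register in iteration `i` (none after termination). -/
def out (i : ℕ) : List Out :=
  if (g.config O i).halted = true then [] else
    (g.alg.next i g.coins (g.config O i).state
      ((g.batch O i).map (Sum.elim O g.sideOracle))).out

theorem config_succ_of_halted {i : ℕ} (h : (g.config O i).halted = true) :
    g.config O (i + 1) = g.config O i := by
  unfold config at h ⊢
  rw [PROMAlgorithm.config]
  simp only [h, if_true]

theorem config_succ_of_not_halted {i : ℕ} (h : (g.config O i).halted = false) :
    g.config O (i + 1) =
      let r := g.alg.next i g.coins (g.config O i).state
        ((g.batch O i).map (Sum.elim O g.sideOracle))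
      ⟨r.state, (g.config O i).register ++ r.out, r.halt⟩ := by
  have hb : g.batch O i = g.alg.query i g.coins (g.config O i).state := by
    simp [batch, h]
  rw [hb]
  unfold config at h ⊢
  rw [PROMAlgorithm.config]
  simp [h]

theorem register_succ (i : ℕ) :
    (g.config O (i + 1)).register = (g.config O i).register ++ g.out O i := by
  cases h : (g.config O i).halted
  · rw [g.config_succ_of_not_halted O h]
    simp [out, h]
  · rw [g.config_succ_of_halted O h]
    simp [out, h]

theorem mem_register {i : ℕ} {p : Out} :
    p ∈ (g.config O i).register ↔ ∃ s < i, p ∈ g.out O s := by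
  induction i with
  | zero => simp [config, PROMAlgorithm.config]
  | succ i ih =>
    rw [register_succ, List.mem_append, ih]
    constructor
    · rintro (⟨s, hs, hp⟩ | hp)
      · exact ⟨s, hs.trans (Nat.lt_succ_self i), hp⟩
      · exact ⟨i, Nat.lt_succ_self i, hp⟩
    · rintro ⟨s, hs, hp⟩
      rcases Nat.lt_succ_iff_lt_or_eq.1 hs with hs | rfl
      · exact Or.inl ⟨s, hs, hp⟩
      · exact Or.inr hp

theorem config_of_halted {i j : ℕ} (hij : i ≤ j) (h : (g.config O i).halted = true) :
    g.config O j = g.config O i := by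
  induction j, hij using Nat.le_induction with
  | base => rfl
  | succ j _ ih => rw [g.config_succ_of_halted O (by rw [ih, h]), ih]

theorem not_halted_of_le {i j : ℕ} (hij : i ≤ j) (h : (g.config O j).halted = false) :
    (g.config O i).halted = false := by
  by_contra hi
  rw [Bool.not_eq_false] at hi
  rw [g.config_of_halted O hij hi, hi] at h
  exact Bool.noConfusion h

theorem not_halted_of_mem_batch {i : ℕ} {x : LabelQuery V δ L ⊕ E} (h : x ∈ g.batch O i) :
    (g.config O i).halted = false := by
  by_contra hi
  rw [Bool.not_eq_false] at hi
  simp [batch, hi] at h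

theorem not_halted_of_mem_out {i : ℕ} {x : Out} (h : x ∈ g.out O i) :
    (g.config O i).halted = false := by
  by_contra hi
  rw [Bool.not_eq_false] at hi
  simp [out, hi] at h

variable [NeZero δ]

/-- The correct query of `v`. -/
abbrev query (v : V) : LabelQuery V δ L := g.graph.labelQuery O g.inputLabel v

/-- The label of `v`. -/
abbrev label (v : V) : L := g.graph.label O g.inputLabel v

/-- The correct query of `v` is made in iteration `i`. -/
def Queried (i : ℕ) (v : V) : Prop := Sum.inl (g.query O v) ∈ g.batch O i

/-- The label of `v` is an argument of a correct query made in iteration `i`. -/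
def Used (i : ℕ) (v : V) : Prop := ∃ w, g.graph.Adj v w ∧ g.Queried O i w

/-- The vertex `v` is pebbled at time `t` if its label is used, or can be read off from the output,
at some time from `t` on, although its correct query has not been answered since time `t`. The label
then has to be encoded in the state at time `t`. Queries of one iteration are answered before the
iteration writes its output, but after all of them have been chosen, which accounts for the two
different bounds on `r`. -/
def Pebbled (t : ℕ) (v : V) : Prop :=
  ∃ s ≥ t, (g.Used O s v ∧ ∀ r, t ≤ r → r < s → ¬ g.Queried O r v) ∨
    ((g.read v (g.out O s)).isSome ∧ ∀ r, t ≤ r → r ≤ s → ¬ g.Queried O r v)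

theorem pebbled_of_queried {t : ℕ} {u w : V} (huw : g.graph.Adj u w) (hw : g.Queried O t w) :
    g.Pebbled O t u :=
  ⟨t, le_rfl, Or.inl ⟨⟨w, huw, hw⟩, fun _ h₁ h₂ => absurd h₂ (by omega)⟩⟩

theorem pebbled_or_queried_of_pebbled_succ {t : ℕ} {v : V} (h : g.Pebbled O (t + 1) v) :
    g.Pebbled O t v ∨ g.Queried O t v := by
  by_cases hq : g.Queried O t v
  · exact Or.inr hq
  · left
    obtain ⟨s, hs, h | h⟩ := h
    · refine ⟨s, by omega, Or.inl ⟨h.1, fun r h₁ h₂ => ?_⟩⟩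
      rcases h₁.eq_or_lt with rfl | h₁
      · exact hq
      · exact h.2 r h₁ h₂
    · refine ⟨s, by omega, Or.inr ⟨h.1, fun r h₁ h₂ => ?_⟩⟩
      rcases h₁.eq_or_lt with rfl | h₁
      · exact hq
      · exact h.2 r h₁ h₂

theorem exists_queried_of_read {s : ℕ} {v : V} (h : (g.read v (g.out O s)).isSome)
    (hv : ¬ g.Pebbled O 0 v) : ∃ t, g.Queried O t v := by
  by_contra! hq
  exact hv ⟨s, Nat.zero_le s, Or.inr ⟨h, fun r _ _ => hq r⟩⟩

/-! ### Incompressibility of the labeling oracle -/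

/-- What has to be known about a pebbled vertex besides the state: the iteration in which its label
appears, the place in the batch where it appears (query number and argument number; `none` if it is
read off from the output), and the place of its first correct query, if there is one. -/
abbrev Hint (V : Type) (N δ : ℕ) : Type :=
  V × (Fin N × Option (Fin N × Fin δ)) × Option (Fin N × Fin N)

/-- The hint is correct for the run from time `t` on. -/
structure Hint.Correct {N : ℕ} (t : ℕ) (c : Hint V N δ) : Prop where
  le_use : t ≤ c.2.1.1.val
  label_eq : (match c.2.1.2 with
    | some jk => BoundedDAG.labelAt (g.batch O c.2.1.1) jk.1 jk.2
    | none => g.read c.1 (g.out O c.2.1.1)) = some (g.label O c.1)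
  not_queried : ∀ r, t ≤ r → r < c.2.1.1.val → ¬ g.Queried O r c.1
  not_queried_of_none : c.2.1.2 = none → ¬ g.Queried O c.2.1.1 c.1
  query_none : c.2.2 = none → ∀ r ≥ t, ¬ g.Queried O r c.1
  query_some : ∀ rj, c.2.2 = some rj → t ≤ rj.1.val ∧
    (g.batch O rj.1)[rj.2.val]? = some (Sum.inl (g.query O c.1)) ∧
    ∀ r, t ≤ r → r < rj.1.val → ¬ g.Queried O r c.1

/-- The conditions on an oracle under which hints of bounded size exist: values read off from the
output are labels, and there are at most `N` iterations with at most `N` queries each. -/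
structure Regular (N : ℕ) : Prop where
  read_eq : ∀ i v ℓ, g.read v (g.out O i) = some ℓ → ℓ = g.label O v
  read_nil : ∀ v, g.read v [] = none
  halted : (g.config O N).halted = true
  batch_le : ∀ i, (g.batch O i).length ≤ N

variable {g O}

theorem Regular.lt_of_not_halted {N : ℕ} (h : g.Regular O N) {i : ℕ}
    (hi : (g.config O i).halted = false) : i < N := by
  by_contra hN
  have := g.not_halted_of_le O (not_lt.1 hN) hi
  rw [h.halted] at this
  exact Bool.noConfusion this

theorem Regular.exists_hint {N : ℕ} (h : g.Regular O N) {t : ℕ} {v : V} (hv : g.Pebbled O t v) :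
    ∃ c : Hint V N δ, c.1 = v ∧ Hint.Correct g O t c := by
  classical
  have hquery : ∃ o : Option (Fin N × Fin N), (o = none → ∀ r ≥ t, ¬ g.Queried O r v) ∧
      ∀ rj, o = some rj → t ≤ rj.1.val ∧
        (g.batch O rj.1)[rj.2.val]? = some (Sum.inl (g.query O v)) ∧
        ∀ r, t ≤ r → r < rj.1.val → ¬ g.Queried O r v := by
    by_cases hq : ∃ r, t ≤ r ∧ g.Queried O r v
    · obtain ⟨h₁, h₂⟩ := Nat.find_spec hq
      obtain ⟨j, hj, hjv⟩ := List.getElem_of_mem h₂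
      have hN := h.lt_of_not_halted (g.not_halted_of_mem_batch O h₂)
      refine ⟨some (⟨Nat.find hq, hN⟩, ⟨j, hj.trans_le (h.batch_le _)⟩), by simp, ?_⟩
      rintro rj hrj
      obtain rfl := Option.some.inj hrj
      refine ⟨h₁, ?_, fun r hr hlt hqr => Nat.find_min hq hlt ⟨hr, hqr⟩⟩
      rw [List.getElem?_eq_getElem hj, hjv]
    · exact ⟨none, fun _ r hr hqr => hq ⟨r, hr, hqr⟩, by simp⟩
  obtain ⟨o, ho₁, ho₂⟩ := hquery
  obtain ⟨s, hs, ⟨⟨w, hvw, hw⟩, hnq⟩ | ⟨hread, hnq⟩⟩ := hv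
  · obtain ⟨j, hj, k, hk, hjk⟩ := g.graph.exists_labelAt O g.inputLabel hvw hw
    have hN := h.lt_of_not_halted (g.not_halted_of_mem_batch O hw)
    exact ⟨(v, (⟨s, hN⟩, some (⟨j, hj.trans_le (h.batch_le _)⟩, ⟨k, hk⟩)), o), rfl,
      ⟨hs, hjk, hnq, by simp, ho₁, ho₂⟩⟩
  · have hN : s < N := by
      refine h.lt_of_not_halted ?_
      by_contra hi
      rw [Bool.not_eq_false] at hi
      simp [out, hi, h.read_nil] at hread
    obtain ⟨ℓ, hℓ⟩ := Option.isSome_iff_exists.1 hread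
    refine ⟨(v, (⟨s, hN⟩, none), o), rfl,
      ⟨hs, ?_, fun r h₁ h₂ => hnq r h₁ h₂.le, fun _ => hnq s hs le_rfl, ho₁, ho₂⟩⟩
    change g.read v (g.out O s) = _
    rw [hℓ, h.read_eq _ _ _ hℓ]

variable (g) in
/-- Overwrite the oracle by `z` at the correct queries of the vertices `v k`. -/
noncomputable def overwrite {ι : Type} (v : ι → V) (O : LabelQuery V δ L → L) (z : ι → L) :
    LabelQuery V δ L → L :=
  Function.extend (fun k => g.query O (v k)) z O

theorem label_eq_of_config_eq {N : ℕ} {O' : LabelQuery V δ L → L} {t s : ℕ} {c : Hint V N δ}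
    (hc : Hint.Correct g O t c) (hc' : Hint.Correct g O' t c)
    (hbatch : ∀ r, t ≤ r → r ≤ s → g.batch O r = g.batch O' r)
    (hout : ∀ r, t ≤ r → r < s → g.out O r = g.out O' r)
    (hlt : c.2.1.1.val < s ∨ (c.2.1.1.val = s ∧ c.2.1.2 ≠ none)) :
    g.label O c.1 = g.label O' c.1 := by
  have h := hc.label_eq
  have h' := hc'.label_eq
  have ht := hc.le_use
  apply Option.some_injective
  rw [← h, ← h']
  rcases hu : c.2.1.2 with _ | jk
  · simp only
    rw [hout _ ht (by rcases hlt with hlt | hlt; exacts [hlt, absurd hu hlt.2])]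
  · simp only
    rw [hbatch _ ht (by omega)]

/-- If two oracles agree after overwriting, and have the same state at time `t` and the same
correct hints, then their runs answer alike the queries of iteration `s`, as long as they agree
before. -/
theorem answer_eq {N : ℕ} {ι : Type} {O' : LabelQuery V δ L → L} {t s : ℕ} (hts : t ≤ s)
    {c : ι → Hint V N δ} (hc : ∀ k, Hint.Correct g O t (c k))
    (hc' : ∀ k, Hint.Correct g O' t (c k)) {z z' : ι → L}
    (hO : g.overwrite (fun k => (c k).1) O z = g.overwrite (fun k => (c k).1) O' z')
    (hbatch : ∀ r, t ≤ r → r ≤ s → g.batch O r = g.batch O' r)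
    (hout : ∀ r, t ≤ r → r < s → g.out O r = g.out O' r)
    {y : LabelQuery V δ L} (hy : Sum.inl y ∈ g.batch O s) : O y = O' y := by
  -- a query that is correct for one of the oracles is, by the hint on its first occurrence,
  -- correct for the other one, and its answer is the label pointed to by the hint
  have key : ∀ {O O' : LabelQuery V δ L → L}, (∀ k, Hint.Correct g O t (c k)) →
      (∀ k, Hint.Correct g O' t (c k)) →
      (∀ r, t ≤ r → r ≤ s → g.batch O r = g.batch O' r) →
      (∀ r, t ≤ r → r < s → g.out O r = g.out O' r) →
      Sum.inl y ∈ g.batch O s → ∀ k, g.query O (c k).1 = y → O y = O' y := by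
    intro O O' hc hc' hbatch hout hy k hk
    have hq : g.Queried O s (c k).1 := by rw [Queried, hk]; exact hy
    have hqq : g.query O (c k).1 = g.query O' (c k).1 := by
      rcases ho : (c k).2.2 with _ | rj
      · exact absurd hq ((hc k).query_none ho s hts)
      · obtain ⟨h₁, h₂, h₃⟩ := (hc k).query_some rj ho
        obtain ⟨-, h₂', -⟩ := (hc' k).query_some rj ho
        have hle : rj.1.val ≤ s := by
          by_contra hlt
          exact h₃ s hts (not_le.1 hlt) hq
        rw [hbatch _ h₁ hle, h₂'] at h₂
        exact (Sum.inl.inj (Option.some.inj h₂)).symm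
    have hlab : g.label O (c k).1 = g.label O' (c k).1 := by
      refine label_eq_of_config_eq (hc k) (hc' k) hbatch hout ?_
      rcases lt_trichotomy (c k).2.1.1.val s with h | h | h
      · exact Or.inl h
      · refine Or.inr ⟨h, fun hn => (hc k).not_queried_of_none hn ?_⟩
        rw [h]
        exact hq
      · exact absurd hq ((hc k).not_queried s hts h)
    rw [← hk]
    rw [label, BoundedDAG.label_eq] at hlab
    rw [hlab, label, BoundedDAG.label_eq]
    exact congrArg O' hqq.symm
  by_cases h : ∃ k, g.query O (c k).1 = y
  · obtain ⟨k, hk⟩ := h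
    exact key hc hc' hbatch hout hy k hk
  by_cases h' : ∃ k, g.query O' (c k).1 = y
  · obtain ⟨k, hk⟩ := h'
    refine (key hc' hc (fun r h₁ h₂ => (hbatch r h₁ h₂).symm)
      (fun r h₁ h₂ => (hout r h₁ h₂).symm) ?_ k hk).symm
    rwa [← hbatch s hts le_rfl]
  have := congrFun hO y
  rwa [overwrite, overwrite, Function.extend_apply' _ _ _ h,
    Function.extend_apply' _ _ _ h'] at this

/-- Under the hypotheses of `answer_eq`, the two runs coincide from time `t` on. -/
theorem run_eq {N : ℕ} {ι : Type} {O' : LabelQuery V δ L → L} {t : ℕ}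
    (hstate : (g.config O t).state = (g.config O' t).state)
    (hhalt : (g.config O t).halted = (g.config O' t).halted)
    {c : ι → Hint V N δ} (hc : ∀ k, Hint.Correct g O t (c k))
    (hc' : ∀ k, Hint.Correct g O' t (c k)) {z z' : ι → L}
    (hO : g.overwrite (fun k => (c k).1) O z = g.overwrite (fun k => (c k).1) O' z')
    {s : ℕ} (hs : t ≤ s) :
    g.batch O s = g.batch O' s ∧ g.out O s = g.out O' s := by
  have batch_eq : ∀ r, (g.config O r).state = (g.config O' r).state →
      (g.config O r).halted = (g.config O' r).halted → g.batch O r = g.batch O' r := by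
    intro r h₁ h₂
    simp only [batch, h₁, h₂]
  have main : ∀ s, t ≤ s →
      ((g.config O s).state = (g.config O' s).state ∧
        (g.config O s).halted = (g.config O' s).halted) ∧
      (∀ r, t ≤ r → r ≤ s → g.batch O r = g.batch O' r) ∧
      ∀ r, t ≤ r → r < s → g.out O r = g.out O' r := by
    intro s hs
    induction s, hs using Nat.le_induction with
    | base =>
      refine ⟨⟨hstate, hhalt⟩, fun r h₁ h₂ => ?_, fun r h₁ h₂ => absurd h₂ (by omega)⟩
      obtain rfl := le_antisymm h₁ h₂
      exact batch_eq _ hstate hhalt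
    | succ s hs ih =>
      obtain ⟨⟨ih₁, ih₂⟩, ih₃, ih₄⟩ := ih
      have hb := ih₃ s hs le_rfl
      have hans : (g.batch O s).map (Sum.elim O g.sideOracle) =
          (g.batch O' s).map (Sum.elim O' g.sideOracle) := by
        rw [← hb]
        refine List.map_congr_left fun x hx => ?_
        rcases x with y | e
        · exact answer_eq hs hc hc' hO ih₃ ih₄ hx
        · rfl
      have hnext : ((g.config O (s + 1)).state = (g.config O' (s + 1)).state ∧
          (g.config O (s + 1)).halted = (g.config O' (s + 1)).halted) := by
        cases hh : (g.config O s).halted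
        · rw [g.config_succ_of_not_halted O hh,
            g.config_succ_of_not_halted O' (by rw [← ih₂, hh])]
          simp only [hans, ih₁, and_self]
        · rw [g.config_succ_of_halted O hh, g.config_succ_of_halted O' (by rw [← ih₂, hh])]
          exact ⟨ih₁, ih₂⟩
      refine ⟨hnext, fun r h₁ h₂ => ?_, fun r h₁ h₂ => ?_⟩
      · rcases h₂.eq_or_lt with rfl | h₂
        · exact batch_eq _ hnext.1 hnext.2
        · exact ih₃ r h₁ (by omega)
      · rcases (Nat.lt_succ_iff.1 h₂).eq_or_lt with rfl | h₂
        · simp only [out, hans, ih₁, ih₂]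
        · exact ih₄ r h₁ h₂
  obtain ⟨⟨_, _⟩, h₃, h₄⟩ := main (s + 1) (by omega)
  exact ⟨h₃ s hs (by omega), h₄ s hs (by omega)⟩

/-- The state at one time and the hints determine, together with the values of the oracle outside
the correct queries of the hinted vertices, the whole oracle. -/
theorem overwrite_injective {N : ℕ} {ι : Type} {O' : LabelQuery V δ L → L} {t : ℕ}
    (hstate : (g.config O t).state = (g.config O' t).state)
    (hhalt : (g.config O t).halted = (g.config O' t).halted)
    {c : ι → Hint V N δ} (hinj : Function.Injective fun k => (c k).1)
    (hc : ∀ k, Hint.Correct g O t (c k))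
    (hc' : ∀ k, Hint.Correct g O' t (c k)) {z z' : ι → L}
    (hO : g.overwrite (fun k => (c k).1) O z = g.overwrite (fun k => (c k).1) O' z') :
    O = O' ∧ z = z' := by
  -- the runs agree, so the hints point to the same labels in both of them; the other labels are
  -- computed from these, without the overwritten values
  have hlab : ∀ k, g.label O (c k).1 = g.label O' (c k).1 := fun k =>
    label_eq_of_config_eq (s := (c k).2.1.1.val + 1) (hc k) (hc' k)
      (fun r h₁ _ => (run_eq hstate hhalt hc hc' hO h₁).1)
      (fun r h₁ _ => (run_eq hstate hhalt hc hc' hO h₁).2) (Or.inl (Nat.lt_succ_self _))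
  have hlabel : ∀ v, g.label O v = g.label O' v := by
    intro v
    induction v using g.graph.acyclic.induction with
    | _ v ih =>
    by_cases hv : ∃ k, (c k).1 = v
    · obtain ⟨k, rfl⟩ := hv
      exact hlab k
    · have hq : g.query O v = g.query O' v := g.graph.labelQuery_congr ih
      have h₁ : ¬ ∃ k, g.query O (c k).1 = g.query O v := fun ⟨k, hk⟩ =>
        hv ⟨k, g.graph.labelQuery_injective O _ hk⟩
      have h₂ : ¬ ∃ k, g.query O' (c k).1 = g.query O v := fun ⟨k, hk⟩ =>
        hv ⟨k, g.graph.labelQuery_injective O' _ (hk.trans hq)⟩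
      have := congrFun hO (g.query O v)
      rw [overwrite, overwrite, Function.extend_apply' _ _ _ h₁,
        Function.extend_apply' _ _ _ h₂] at this
      rw [label, BoundedDAG.label_eq, label, BoundedDAG.label_eq]
      exact this.trans (congrArg O' hq)
  have hquery : ∀ v, g.query O v = g.query O' v := fun v =>
    g.graph.labelQuery_congr fun u _ => hlabel u
  constructor
  · funext y
    by_cases hy : ∃ k, g.query O (c k).1 = y
    · obtain ⟨k, rfl⟩ := hy
      have := hlab k
      rw [label, BoundedDAG.label_eq, label, BoundedDAG.label_eq] at this
      exact this.trans (congrArg O' (hquery _).symm)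
    · have hy' : ¬ ∃ k, g.query O' (c k).1 = y := by
        simpa only [← hquery] using hy
      have := congrFun hO y
      rwa [overwrite, overwrite, Function.extend_apply' _ _ _ hy,
        Function.extend_apply' _ _ _ hy'] at this
  · have hqinj : ∀ O, Function.Injective fun k => g.query O (c k).1 := fun O =>
      (g.graph.labelQuery_injective O _).comp hinj
    funext k
    have := congrFun hO (g.query O (c k).1)
    have hr : g.overwrite (fun k => (c k).1) O' z' (g.query O (c k).1) = z' k := by
      rw [hquery]
      exact (hqinj O').extend_apply _ _ k
    rw [hr] at this
    rw [← this]
    exact ((hqinj O).extend_apply _ _ k).symm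

/-- Few oracles admit a state of fewer than `m` bits at a time when `h` vertices are pebbled. -/
theorem card_le (g : LabelingGame V δ L E C Out) [Fintype L] (N m h : ℕ) :
    Nat.card {O : LabelQuery V δ L → L // g.Regular O N ∧ ∃ t,
        (g.config O t).halted = false ∧ (g.config O t).state.length < m ∧
        h ≤ {v | g.Pebbled O t v}.ncard} * Fintype.card L ^ h ≤
      N * 2 ^ m * (Fintype.card V * (N * (N * δ + 1)) * (N * N + 1)) ^ h *
        Nat.card (LabelQuery V δ L → L) := by
  classical
  let Code := Fin N × (Σ n : Fin m, Fin n → Bool) × (Fin h → Hint V N δ)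
  let S := {O : LabelQuery V δ L → L // g.Regular O N ∧ ∃ t,
        (g.config O t).halted = false ∧ (g.config O t).state.length < m ∧
        h ≤ {v | g.Pebbled O t v}.ncard}
  have hcode : ∀ O : S, ∃ c : Code, (g.config O.1 c.1).halted = false ∧
      (g.config O.1 c.1).state = List.ofFn c.2.1.2 ∧
      (Function.Injective fun k => (c.2.2 k).1) ∧
      ∀ k, Hint.Correct g O.1 c.1 (c.2.2 k) := by
    rintro ⟨O, hreg, t, hhalt, hlen, hcard⟩
    obtain ⟨T, hT, hTh⟩ := Finset.exists_subset_card_eq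
      (n := h) (s := {v | g.Pebbled O t v}.toFinset) (by rwa [Set.ncard_eq_toFinset_card'] at hcard)
    have hhint : ∀ k : Fin h, ∃ c : Hint V N δ,
        c.1 = (T.equivFinOfCardEq hTh).symm k ∧ Hint.Correct g O t c := fun k =>
      hreg.exists_hint (by
        simpa using hT ((T.equivFinOfCardEq hTh).symm k).2)
    choose c hc₁ hc₂ using hhint
    refine ⟨(⟨t, hreg.lt_of_not_halted hhalt⟩, ⟨⟨_, hlen⟩, (g.config O t).state.get⟩, c),
      hhalt, (List.ofFn_get _).symm, fun k k' hk => ?_, hc₂⟩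
    simp only [hc₁] at hk
    exact (T.equivFinOfCardEq hTh).symm.injective (Subtype.ext hk)
  choose code hhalt hstate hinj hcorrect using hcode
  let Φ : S × (Fin h → L) → Code × (LabelQuery V δ L → L) := fun p =>
    (code p.1, g.overwrite (fun k => ((code p.1).2.2 k).1) p.1.1 p.2)
  have hΦ : Function.Injective Φ := by
    rintro ⟨O, z⟩ ⟨O', z'⟩ hp
    obtain ⟨h₁, h₂⟩ := Prod.ext_iff.1 hp
    simp only [Φ] at h₁ h₂
    have e₁ := hhalt O'
    have e₂ := hstate O'
    have e₃ := hcorrect O'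
    rw [← h₁] at h₂ e₁ e₂ e₃
    obtain ⟨h₃, h₄⟩ := overwrite_injective ((hstate O).trans e₂.symm)
      ((hhalt O).trans e₁.symm) (hinj O) (hcorrect O) e₃ h₂
    exact Prod.ext (Subtype.ext h₃) h₄
  have hle := Nat.card_le_card_of_injective Φ hΦ
  have hσ : Nat.card (Σ n : Fin m, Fin n → Bool) ≤ 2 ^ m := by
    rw [Nat.card_eq_fintype_card, Fintype.card_sigma]
    simp only [Fintype.card_fun, Fintype.card_bool, Fintype.card_fin]
    rw [Fin.sum_univ_eq_sum_range (fun n => 2 ^ n) m]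
    exact (Nat.geomSum_lt le_rfl fun k hk => Finset.mem_range.1 hk).le
  have hS : Nat.card (S × (Fin h → L)) = Nat.card S * Fintype.card L ^ h := by
    rw [Nat.card_prod, Nat.card_fun, Nat.card_fin, Nat.card_eq_fintype_card (α := L)]
  have hC : Nat.card Code = N * (Nat.card (Σ n : Fin m, Fin n → Bool) *
      (Fintype.card V * (N * (N * δ + 1)) * (N * N + 1)) ^ h) := by
    simp only [Code, Nat.card_prod, Nat.card_fun, Nat.card_fin, Finite.card_option,
      Nat.card_eq_fintype_card (α := V)]
    ring
  rw [hS, Nat.card_prod, hC] at hle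
  refine hle.trans (Nat.mul_le_mul_right _ ?_)
  rw [mul_assoc N (2 ^ m)]
  exact Nat.mul_le_mul_left _ (Nat.mul_le_mul_right _ hσ)

end LabelingGame

/-! ### Pebbling the cylinder -/

/-- The vertex in column `m` (modulo `h`) of level `i` (capped to the top level). -/
def cylinderVertex {h : ℕ} (hh : 0 < h) (i m : ℕ) : CylinderVertex h :=
  toLex (⟨min i (2 * h - 1), by omega⟩, ⟨m % h, Nat.mod_lt m hh⟩)

theorem cylinderAdj_cylinderVertex {h : ℕ} (hh : 0 < h) {i m m' : ℕ} (hi : i + 1 < 2 * h)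
    (hm : m' = m ∨ m' = m + 1) :
    cylinderAdj h (cylinderVertex hh i m) (cylinderVertex hh (i + 1) m') := by
  refine ⟨?_, ?_⟩
  · simp only [cylinderVertex, ofLex_toLex]
    omega
  · simp only [cylinderVertex, ofLex_toLex]
    rcases hm with rfl | rfl
    · exact Or.inl rfl
    · exact Or.inr (by rw [Nat.mod_add_mod])

theorem cylinderVertex_inj {h : ℕ} (hh : 0 < h) {i i' m m' : ℕ} (hi : i < 2 * h)
    (hi' : i' < 2 * h) (heq : cylinderVertex hh i m = cylinderVertex hh i' m') :
    i = i' ∧ m % h = m' % h := by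
  have h₁ := congrArg (fun v => (ofLex v).1.val) heq
  have h₂ := congrArg (fun v => (ofLex v).2.val) heq
  simp only [cylinderVertex, ofLex_toLex] at h₁ h₂
  exact ⟨by omega, h₂⟩

/-- The columns visited by an ascending path, with columns counted in the universal cover. -/
def IsColumnPath (c : ℕ → ℕ) : Prop := ∀ i, c (i + 1) = c i ∨ c (i + 1) = c i + 1

theorem IsColumnPath.mono {c : ℕ → ℕ} (hc : IsColumnPath c) {i j : ℕ} (hij : i ≤ j) :
    c i ≤ c j := by
  induction j, hij using Nat.le_induction with
  | base => exact le_rfl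
  | succ j _ ih => rcases hc j with h | h <;> omega

theorem IsColumnPath.le_add {c : ℕ → ℕ} (hc : IsColumnPath c) {i j : ℕ} (hij : i ≤ j) :
    c j ≤ c i + (j - i) := by
  induction j, hij using Nat.le_induction with
  | base => simp
  | succ j _ ih => rcases hc j with h | h <;> omega

/-- A path from level `0` to the top level in column `j` (modulo `h`) avoiding `P`. -/
def OpenPath {h : ℕ} (hh : 0 < h) (P : CylinderVertex h → Prop) (j : ℕ) (c : ℕ → ℕ) : Prop :=
  IsColumnPath c ∧ c (2 * h - 1) % h = j % h ∧ ∀ i < 2 * h, ¬ P (cylinderVertex hh i (c i))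

theorem not_modEq_of_lt {h x y : ℕ} (hxy : x < y) (hyx : y < x + h) : x % h ≠ y % h := by
  intro hmod
  have := (Nat.modEq_iff_dvd' hxy.le).1 hmod
  have := Nat.le_of_dvd (by omega) this
  omega

/-- Suppose that `P` meets every ascending path to the top vertex in column `j`, but avoids the part
above level `s` of one of them. Then `P` has at least `h` elements. Indeed, there are `h` disjoint
paths from level `0` to that part: those starting to the right of it go straight up, those starting
to the left of it follow the diagonals from level `s` on, and both continue along the given path
once they meet it. -/
theorem le_ncard_of_forall_not_openPath {h : ℕ} (hh : 0 < h) (P : CylinderVertex h → Prop) {j : ℕ}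
    (hP : ∀ c, ¬ OpenPath hh P j c) {c : ℕ → ℕ} (hc : IsColumnPath c)
    (hcj : c (2 * h - 1) % h = j % h) {s : ℕ} (hs : s ≤ h)
    (hfree : ∀ i, s ≤ i → i < 2 * h → ¬ P (cylinderVertex hh i (c i))) :
    h ≤ {v | P v}.ncard := by
  -- The path `u` starts in column `B + u` and follows the given path, moved by a full turn, as
  -- far as it can: its column stays between the vertical and the diagonal (from level `s` on)
  -- through its start. From level `s + h - 1` on it coincides with the given path.
  set B := c (s + h - 1) + 1 with hB
  let p : ℕ → ℕ → ℕ := fun u i => max (B + u) (min (c i + h) (B + u + (i - s)))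
  have hp : ∀ u, IsColumnPath (p u) := fun u i => by
    have := hc i
    simp only [p]
    omega
  have hpend : ∀ u < h, p u (2 * h - 1) = c (2 * h - 1) + h := fun u hu => by
    have h₁ := hc.mono (show s + h - 1 ≤ 2 * h - 1 by omega)
    have h₂ := hc.le_add (show s + h - 1 ≤ 2 * h - 1 by omega)
    simp only [p]
    omega
  have hmeet : ∀ u : Fin h, ∃ i < 2 * h, P (cylinderVertex hh i (p u i)) := fun u => by
    by_contra! hcon
    exact hP (p u) ⟨hp u, by rw [hpend u u.2, Nat.add_mod_right, hcj], hcon⟩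
  choose lev hlev hPlev using hmeet
  -- the pebble on the path `u` lies before the path joins the given one
  have hoff : ∀ u : Fin h, s ≤ lev u → p u (lev u) ≠ c (lev u) + h := fun u hsu heq => by
    refine hfree (lev u) hsu (hlev u) ?_
    have := hPlev u
    rw [heq] at this
    simpa [cylinderVertex] using this
  have hinj : Function.Injective fun u : Fin h => cylinderVertex hh (lev u) (p u (lev u)) := by
    have hlt : ∀ u u' : Fin h, u < u' →
        cylinderVertex hh (lev u) (p u (lev u)) ≠ cylinderVertex hh (lev u') (p u' (lev u')) := by
      intro u u' huu heq
      obtain ⟨h₁, h₂⟩ := cylinderVertex_inj hh (hlev u) (hlev u') heq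
      have ho := hoff u
      have ho' := hoff u'
      rw [← h₁] at h₂ ho'
      have hu' := u'.2
      have huu : u.val < u'.val := huu
      refine not_modEq_of_lt (h := h) ?_ ?_ h₂ <;>
      · simp only [p] at ho ho' ⊢
        omega
    intro u u' heq
    rcases lt_trichotomy u u' with h | h | h
    · exact absurd heq (hlt u u' h)
    · exact h
    · exact absurd heq.symm (hlt u' u h)
  calc h = (Set.range fun u : Fin h => cylinderVertex hh (lev u) (p u (lev u))).ncard := by
        rw [← Set.image_univ, Set.ncard_image_of_injective _ hinj, Set.ncard_univ, Nat.card_fin]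
    _ ≤ {v | P v}.ncard := Set.ncard_le_ncard (by
        rintro _ ⟨u, rfl⟩
        exact hPlev u) (Set.toFinite _)

/-- In a parallel pebbling of the cylinder that starts with fewer than `h` pebbles, there are `h`
consecutive times with at least `h` pebbles, before some vertex is pebbled. -/
theorem exists_sustained_pebbles {h : ℕ} (hh : 0 < h) (Peb Que : ℕ → CylinderVertex h → Prop)
    (legal : ∀ t u w, cylinderAdj h u w → Que t w → Peb t u)
    (step : ∀ t v, Peb (t + 1) v → Peb t v ∨ Que t v)
    (start : {v | Peb 0 v}.ncard < h)
    (finish : ∀ m, ¬ Peb 0 (cylinderVertex hh (2 * h - 1) m) →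
      ∃ t, Que t (cylinderVertex hh (2 * h - 1) m)) :
    ∃ t₀ T v, Que T v ∧ t₀ + h ≤ T + 1 ∧ ∀ s < h, h ≤ {v | Peb (t₀ + s) v}.ncard := by
  classical
  obtain ⟨j, hj⟩ : ∃ j, OpenPath hh (Peb 0) j fun _ => j := by
    by_contra! hcon
    have hmeet : ∀ u : Fin h, ∃ i < 2 * h, Peb 0 (cylinderVertex hh i u) := fun u => by
      by_contra! hnot
      exact hcon u ⟨fun _ => Or.inl rfl, rfl, hnot⟩
    choose lev hlev hP using hmeet
    refine absurd start (not_lt.2 ?_)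
    calc h = (Set.range fun u : Fin h => cylinderVertex hh (lev u) u).ncard := by
          rw [← Set.image_univ, Set.ncard_image_of_injective, Set.ncard_univ, Nat.card_fin]
          intro u u' heq
          have := (cylinderVertex_inj hh (hlev u) (hlev u') heq).2
          rw [Nat.mod_eq_of_lt u.2, Nat.mod_eq_of_lt u'.2] at this
          exact Fin.ext this
      _ ≤ _ := Set.ncard_le_ncard (by
          rintro _ ⟨u, rfl⟩
          exact hP u) (Set.toFinite _)
  obtain ⟨T, hT⟩ := finish j (hj.2.2 _ (by omega))
  -- the last time at which the sink can be reached by a pebble-free path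
  let I := (Finset.range (T + 1)).filter fun t => ∃ c, OpenPath hh (Peb t) j c
  have hI : I.Nonempty := ⟨0, by simpa [I] using ⟨_, hj⟩⟩
  obtain ⟨hlast, c, hc, hcj, hfree⟩ : I.max' hI ∈ Finset.range (T + 1) ∧
      ∃ c, OpenPath hh (Peb (I.max' hI)) j c := Finset.mem_filter.1 (I.max'_mem hI)
  set t := I.max' hI
  rw [Finset.mem_range] at hlast
  have hclosed : ∀ r, t < r → r ≤ T → ∀ c, ¬ OpenPath hh (Peb r) j c := fun r h₁ h₂ c hcr =>
    absurd (I.le_max' r (Finset.mem_filter.2 ⟨Finset.mem_range.2 (by omega), c, hcr⟩))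
      (not_le.2 h₁)
  -- the sink is not queried while its predecessor on the path carries no pebble
  have hne : ∀ r, ¬ Peb r (cylinderVertex hh (2 * h - 2) (c (2 * h - 2))) → r ≠ T := by
    rintro r hr rfl
    refine hr (legal r _ _ ?_ hT)
    have hadj := cylinderAdj_cylinderVertex hh (i := 2 * h - 2) (by omega) (hc (2 * h - 2))
    rw [show 2 * h - 2 + 1 = 2 * h - 1 by omega] at hadj
    have hsink : cylinderVertex hh (2 * h - 1) (c (2 * h - 1)) =
        cylinderVertex hh (2 * h - 1) j := by
      simp only [cylinderVertex, hcj]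
    rwa [hsink] at hadj
  -- pebbles climb the path by at most one level per step
  have hclimb : ∀ s, s ≤ h → t + s ≤ T ∧
      ∀ i, s ≤ i → i < 2 * h → ¬ Peb (t + s) (cylinderVertex hh i (c i)) := by
    intro s
    induction s with
    | zero => exact fun _ => ⟨by omega, fun i _ hi => hfree i hi⟩
    | succ s ih =>
      intro hs
      obtain ⟨ih₁, ih₂⟩ := ih (by omega)
      refine ⟨?_, fun i h₁ h₂ hp => ?_⟩
      · have := hne (t + s) (ih₂ _ (by omega) (by omega))
        omega
      · rcases step (t + s) _ hp with hp | hq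
        · exact ih₂ i (by omega) h₂ hp
        · obtain ⟨i, rfl⟩ : ∃ i', i = i' + 1 := ⟨i - 1, by omega⟩
          exact ih₂ i (by omega) (by omega)
            (legal _ _ _ (cylinderAdj_cylinderVertex hh h₂ (hc i)) hq)
  refine ⟨t + 1, T, _, hT, ?_, fun s hs => ?_⟩
  · have := (hclimb h le_rfl).1
    omega
  · obtain ⟨h₁, h₂⟩ := hclimb (s + 1) hs
    rw [show t + 1 + s = t + (s + 1) by ring]
    exact le_ncard_of_forall_not_openPath hh _ (hclosed _ (by omega) h₁) hc hcj hs h₂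

/-! ### Sinks of the cylinder -/

theorem cylinder_sink_iff {h : ℕ} (hh : 0 < h) (v : CylinderVertex h) :
    (∀ w, ¬ cylinderAdj h v w) ↔ (ofLex v).1.val = 2 * h - 1 := by
  have h₁ := (ofLex v).1.2
  constructor
  · intro hv
    by_contra hlt
    refine hv (toLex (⟨(ofLex v).1.val + 1, by omega⟩, (ofLex v).2)) ⟨rfl, Or.inl rfl⟩
  · rintro hv w ⟨hw, -⟩
    have := (ofLex w).1.2
    omega

theorem mem_cylinder_sinks {h : ℕ} (hh : 0 < h) (v : CylinderVertex h) :
    v ∈ (cylinder h).sinks ↔ (ofLex v).1.val = 2 * h - 1 := by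
  rw [← cylinder_sink_iff hh]
  simp [BoundedDAG.sinks, cylinder]

theorem length_cylinder_sinks {h : ℕ} (hh : 0 < h) : (cylinder h).sinks.length = h := by
  have hset : (Finset.univ.filter fun v => ∀ w, ¬ (cylinder h).Adj v w) =
      Finset.univ.image fun j : Fin h => cylinderVertex hh (2 * h - 1) j := by
    ext v
    simp only [Finset.mem_filter, Finset.mem_univ, true_and, Finset.mem_image]
    change (∀ w, ¬ cylinderAdj h v w) ↔ _
    rw [cylinder_sink_iff hh]
    constructor
    · intro hv
      refine ⟨(ofLex v).2, ofLex.injective (Prod.ext (Fin.ext ?_) (Fin.ext ?_))⟩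
      · simp only [cylinderVertex, ofLex_toLex]
        omega
      · simp only [cylinderVertex, ofLex_toLex]
        exact Nat.mod_eq_of_lt (ofLex v).2.2
    · rintro ⟨j, rfl⟩
      simp [cylinderVertex]
  rw [BoundedDAG.sinks, Finset.length_sort, hset, Finset.card_image_of_injective, Finset.card_univ,
    Fintype.card_fin]
  intro u u' heq
  have := (cylinderVertex_inj hh (by omega) (by omega) heq).2
  rw [Nat.mod_eq_of_lt u.2, Nat.mod_eq_of_lt u'.2] at this
  exact Fin.ext this

/-! ### Every sink is looked up -/

theorem div_le_card_toNat_mod {κ h j : ℕ} (hj : j < h) :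
    2 ^ κ / h ≤ (Finset.univ.filter fun y : BitVec κ => y.toNat % h = j).card := by
  have hlt : ∀ i < 2 ^ κ / h, i * h + j < 2 ^ κ := fun i hi => by
    calc i * h + j < (i + 1) * h := by rw [add_mul, one_mul]; omega
      _ ≤ 2 ^ κ / h * h := Nat.mul_le_mul_right _ hi
      _ ≤ 2 ^ κ := Nat.div_mul_le_self _ _
  have hval : ∀ i < 2 ^ κ / h, (BitVec.ofNat κ (i * h + j)).toNat = i * h + j := fun i hi => by
    rw [BitVec.toNat_ofNat, Nat.mod_eq_of_lt (hlt i hi)]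
  calc 2 ^ κ / h = (Finset.range (2 ^ κ / h)).card := (Finset.card_range _).symm
    _ ≤ _ := Finset.card_le_card_of_injOn (fun i => BitVec.ofNat κ (i * h + j)) ?_ ?_
  · intro i hi
    have hi := Finset.mem_range.1 (Finset.mem_coe.1 hi)
    simp only [Finset.coe_filter, Finset.mem_univ, true_and, Set.mem_ofPred_eq]
    rw [hval i hi, Nat.mul_add_mod', Nat.mod_eq_of_lt hj]
  · intro i hi i' hi' heq
    have hi := Finset.mem_range.1 (Finset.mem_coe.1 hi)
    have hi' := Finset.mem_range.1 (Finset.mem_coe.1 hi')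
    have := congrArg BitVec.toNat heq
    simp only at this
    rw [hval i hi, hval i' hi'] at this
    exact Nat.eq_of_mul_eq_mul_right (by omega) (Nat.add_right_cancel this)

/-- The coupon collector bound: the probability that a random function on `κ`-bit strings misses
some residue class modulo `h` on the whole of `X`. -/
theorem card_exists_residue_missed_le {κ h : ℕ} (hh : 0 < h) (hκ : h ≤ 2 ^ κ)
    (X : Finset (BitVec κ)) :
    (Nat.card {f : BitVec κ → BitVec κ // ∃ j < h, ∀ x ∈ X, (f x).toNat % h ≠ j} : ℝ) ≤
      h * Real.exp (-(X.card / (2 * h))) * Nat.card (BitVec κ → BitVec κ) := by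
  classical
  have hhR : (0 : ℝ) < h := Nat.cast_pos.2 hh
  let S : ℕ → Finset (BitVec κ) := fun j => Finset.univ.filter fun y => y.toNat % h ≠ j
  let F : ℕ → Finset (BitVec κ → BitVec κ) := fun j =>
    Fintype.piFinset fun x => if x ∈ X then S j else Finset.univ
  have hcardB : Fintype.card (BitVec κ) = 2 ^ κ := FinEnum.card_bitVec κ ▸ by
    rw [← FinEnum.card_eq_fintypeCard]
  have hS : ∀ j < h, ((S j).card : ℝ) ≤ Real.exp (-(1 / (2 * h))) * 2 ^ κ := by
    intro j hj
    have h₁ := Finset.card_filter_add_card_filter_not (s := (Finset.univ : Finset (BitVec κ)))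
      (fun y => y.toNat % h = j)
    rw [Finset.card_univ, hcardB] at h₁
    have h₂ := div_le_card_toNat_mod (κ := κ) hj
    have h₃ : 2 ^ κ ≤ 2 ^ κ / h * (2 * h) := by
      have := Nat.div_add_mod (2 ^ κ) h
      have := Nat.mod_lt (2 ^ κ) hh
      have : h * 1 ≤ h * (2 ^ κ / h) := Nat.mul_le_mul_left _ (Nat.div_pos hκ hh)
      nlinarith
    have h₃' : (2 : ℝ) ^ κ ≤ ((2 ^ κ / h : ℕ) : ℝ) * (2 * h) := by exact_mod_cast h₃
    have h₄ : (1 / (2 * h) : ℝ) * 2 ^ κ ≤ ((2 ^ κ / h : ℕ) : ℝ) := by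
      rw [one_div, inv_mul_le_iff₀ (by positivity)]
      linarith
    have h₅ : ((2 ^ κ / h : ℕ) : ℝ) + (S j).card ≤ 2 ^ κ := by
      have : 2 ^ κ / h + (S j).card ≤ 2 ^ κ := by
        simp only [S, ne_eq]
        omega
      exact_mod_cast this
    have h₆ := Real.add_one_le_exp (-(1 / (2 * h) : ℝ))
    have h₇ : (0 : ℝ) < 2 ^ κ := by positivity
    nlinarith
  have hF : ∀ j < h, ((F j).card : ℝ) ≤
      Real.exp (-(X.card / (2 * h))) * Nat.card (BitVec κ → BitVec κ) := by
    intro j hj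
    rw [Fintype.card_piFinset, Nat.card_eq_fintype_card, Fintype.card_fun, hcardB]
    push_cast
    calc ∏ x, ((if x ∈ X then S j else Finset.univ).card : ℝ)
        ≤ ∏ x, ((if x ∈ X then Real.exp (-(1 / (2 * h))) else 1) * 2 ^ κ : ℝ) := by
          refine Finset.prod_le_prod (fun _ _ => Nat.cast_nonneg _) fun x _ => ?_
          split_ifs
          · exact hS j hj
          · rw [Finset.card_univ, hcardB]
            simp
      _ = _ := by
          rw [Finset.prod_mul_distrib, Finset.prod_ite_mem, Finset.univ_inter, Finset.prod_const,
            Finset.prod_const, Finset.card_univ, hcardB, ← Real.exp_nat_mul]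
          congr 3
          ring
  have hsub : Nat.card {f : BitVec κ → BitVec κ // ∃ j < h, ∀ x ∈ X, (f x).toNat % h ≠ j} ≤
      ((Finset.range h).biUnion F).card := by
    rw [Nat.card_eq_fintype_card, Fintype.card_subtype]
    refine Finset.card_le_card fun f hf => ?_
    obtain ⟨j, hj, hjf⟩ := (Finset.mem_filter.1 hf).2
    refine Finset.mem_biUnion.2 ⟨j, Finset.mem_range.2 hj, Fintype.mem_piFinset.2 fun x => ?_⟩
    split_ifs with hx
    · exact Finset.mem_filter.2 ⟨Finset.mem_univ _, hjf x hx⟩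
    · exact Finset.mem_univ _
  calc _ ≤ (((Finset.range h).biUnion F).card : ℝ) := by exact_mod_cast hsub
    _ ≤ ∑ j ∈ Finset.range h, ((F j).card : ℝ) := by exact_mod_cast Finset.card_biUnion_le
    _ ≤ ∑ _j ∈ Finset.range h, Real.exp (-(X.card / (2 * h))) *
          Nat.card (BitVec κ → BitVec κ) :=
        Finset.sum_le_sum fun j hj => hF j (Finset.mem_range.1 hj)
    _ = _ := by rw [Finset.sum_const, Finset.card_range, nsmul_eq_mul]; ring

/-- A bound on the probability of an event conditional on all but one of several independent
random choices is a bound on its probability. -/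
theorem card_le_of_forall_fiber {Ω α β : Type} [Finite α] [Finite β] (e : Ω ≃ α × β)
    (S : Ω → Prop) (ε : ℝ)
    (hε : ∀ b, (Nat.card {a // S (e.symm (a, b))} : ℝ) ≤ ε * Nat.card α) :
    (Nat.card {ω // S ω} : ℝ) ≤ ε * Nat.card Ω := by
  classical
  have := Fintype.ofFinite β
  let e' : {ω // S ω} ≃ Σ b : β, {a // S (e.symm (a, b))} :=
    { toFun := fun ω => ⟨(e ω.1).2, (e ω.1).1, by simpa using ω.2⟩
      invFun := fun p => ⟨e.symm (p.2.1, p.1), p.2.2⟩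
      left_inv := fun ω => by simp
      right_inv := fun p => by
        rcases p with ⟨b, a, ha⟩
        simp only
        have := e.apply_symm_apply (a, b)
        refine Sigma.ext (by simp) ?_
        simp only
        refine (Subtype.heq_iff_coe_eq ?_).2 (by simp)
        simp }
  rw [Nat.card_congr e', Nat.card_sigma, Nat.card_congr e, Nat.card_prod]
  push_cast
  calc ∑ b : β, (Nat.card {a // S (e.symm (a, b))} : ℝ) ≤ ∑ _b : β, ε * Nat.card α :=
        Finset.sum_le_sum fun b _ => hε b
    _ = _ := by
        rw [Finset.sum_const, Finset.card_univ, nsmul_eq_mul, Nat.card_eq_fintype_card (α := β)]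
        ring

/-! ### The success probability for one security parameter -/

/-- The hash value of `x` is the label of the sink that is looked up, masked. -/
theorem cylinderSHF_hash {h : ℕ → ℕ} {ζ : ∀ κ, BitVec κ} {κ : ℕ} (hh : 0 < h κ)
    {O : CylinderQuery h κ → BitVec κ} {x : BitVec κ} {v : CylinderVertex (h κ)}
    (hv : (cylinder (h κ)).sinks[(O (Sum.inr x)).toNat % h κ]? = some v) :
    (cylinderSHF h ζ).hash κ O x =
      (cylinder (h κ)).label (fun z => O (Sum.inl z)) (ζ κ) v ^^^ O (Sum.inr (x + 1)) := by
  simp only [SHF.hash, cylinderSHF, singleLookup, Seek, BoundedDAG.graphFunction, List.length_map,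
    length_cylinder_sinks hh, List.getD_eq_getElem?_getD, List.getElem?_map, hv, Option.map_some,
    Option.getD_some]

section FixedParameter

variable {h : ℕ → ℕ} (ζ : ∀ κ, BitVec κ) {κ r : ℕ}
  (A : PROMAlgorithm (CylinderQuery h κ) (BitVec κ) (Fin r → Bool) (BitVec κ × BitVec κ))
  (R : (CylinderQuery h κ → BitVec κ) → List Bool) (X : Finset (BitVec κ)) (Λ : ℝ)

/-- The algorithm outputs the hash values of the elements of `X`, and fewer than `h κ` of its states
have size at least `Λ`. -/
def Succeeds (O : CylinderQuery h κ → BitVec κ) (ρ : Fin r → Bool) : Prop :=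
  (∃ y, A.Outputs O ρ (R O) y ∧
    {p | p ∈ y} = (fun x => (x, (cylinderSHF h ζ).hash κ O x)) '' (X : Set (BitVec κ))) ∧
  A.sustainedMem κ Λ O ρ (R O) < (h κ : ℕ∞)

/-- The labeling game in which the label of the sink `v` is read off from the first output value
for the hash input `xs v`. -/
noncomputable def cylinderGame (O₂ : BitVec κ → BitVec κ) (ρ : Fin r → Bool)
    (xs : CylinderVertex (h κ) → BitVec κ) :
    LabelingGame (CylinderVertex (h κ)) 2 (BitVec κ) (BitVec κ) (Fin r → Bool)
      (BitVec κ × BitVec κ) where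
  graph := cylinder (h κ)
  inputLabel := ζ κ
  alg := A
  sideOracle := O₂
  coins := ρ
  input O₁ := R (Sum.elim O₁ O₂)
  read v l := if v ∈ (cylinder (h κ)).sinks then
      (l.find? fun p => p.1 = xs v).map fun p => p.2 ^^^ O₂ (xs v + 1)
    else none

variable {ζ A R X Λ}

/-- A successful run has a state of fewer than `Λ` words at a time when `h κ` vertices are
pebbled. -/
theorem Succeeds.exists_pebbled {N : ℕ} (hh : 0 < h κ) {O₂ : BitVec κ → BitVec κ}
    {ρ : Fin r → Bool} {xs : CylinderVertex (h κ) → BitVec κ}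
    (hxs : ∀ v ∈ (cylinder (h κ)).sinks, xs v ∈ X ∧
      (cylinder (h κ)).sinks[(O₂ (xs v)).toNat % h κ]? = some v)
    (hhalt : ∀ O ρ, (A.config O ρ (R O) N).halted = true)
    (hquery : ∀ O ρ i, (A.config O ρ (R O) i).halted = false →
      (A.query i ρ (A.config O ρ (R O) i).state).length ≤ N)
    (hR : ∀ O, ((R O).length : ℝ) < Λ * κ)
    {O₁ : LabelQuery (CylinderVertex (h κ)) 2 (BitVec κ) → BitVec κ}
    (hsucc : Succeeds ζ A R X Λ (Sum.elim O₁ O₂) ρ) :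
    (cylinderGame ζ A R O₂ ρ xs).Regular O₁ N ∧ ∃ t,
      ((cylinderGame ζ A R O₂ ρ xs).config O₁ t).halted = false ∧
      ((cylinderGame ζ A R O₂ ρ xs).config O₁ t).state.length < ⌈Λ * κ⌉₊ ∧
      h κ ≤ {v | (cylinderGame ζ A R O₂ ρ xs).Pebbled O₁ t v}.ncard := by
  classical
  set g := cylinderGame ζ A R O₂ ρ xs with hg
  obtain ⟨⟨y, ⟨i₀, hi₀, hreg⟩, hy⟩, hmem⟩ := hsucc
  change (g.config O₁ i₀).halted = true at hi₀
  change (g.config O₁ i₀).register = y at hreg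
  have hhash : ∀ v ∈ (cylinder (h κ)).sinks,
      (cylinderSHF h ζ).hash κ (Sum.elim O₁ O₂) (xs v) = g.label O₁ v ^^^ O₂ (xs v + 1) :=
    fun v hv => cylinderSHF_hash (O := Sum.elim O₁ O₂) hh (hxs v hv).2
  have hout : ∀ i, ∀ p ∈ g.out O₁ i, p.2 = (cylinderSHF h ζ).hash κ (Sum.elim O₁ O₂) p.1 := by
    intro i p hp
    have hi : i < i₀ := by
      by_contra hle
      have := g.not_halted_of_le O₁ (not_lt.1 hle) (g.not_halted_of_mem_out O₁ hp)
      rw [hi₀] at this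
      exact Bool.noConfusion this
    have hpy : p ∈ {p | p ∈ y} := by
      rw [← hreg]
      exact (g.mem_register O₁).2 ⟨i, hi, hp⟩
    rw [hy] at hpy
    obtain ⟨x, -, rfl⟩ := hpy
    rfl
  have hregular : g.Regular O₁ N := by
    refine ⟨fun i v ℓ hℓ => ?_, fun v => ?_, hhalt _ _, fun i => ?_⟩
    · change (if v ∈ (cylinder (h κ)).sinks then
        ((g.out O₁ i).find? fun p => p.1 = xs v).map fun p => p.2 ^^^ O₂ (xs v + 1)
        else none) = some ℓ at hℓ
      split_ifs at hℓ with hv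
      obtain ⟨p, hp, rfl⟩ := Option.map_eq_some_iff.1 hℓ
      have hp₁ : p.1 = xs v := by simpa using List.find?_some hp
      rw [hout i p (List.mem_of_find?_eq_some hp), hp₁, hhash v hv, BitVec.xor_assoc,
        BitVec.xor_self, BitVec.xor_zero]
    · simp [hg, cylinderGame]
    · unfold LabelingGame.batch
      split_ifs with hi
      · simp
      · exact hquery (Sum.elim O₁ O₂) ρ i (Bool.eq_false_of_not_eq_true hi)
  refine ⟨hregular, ?_⟩
  by_contra! hsmall
  obtain ⟨t₀, T, v, hT, htT, hpeb⟩ := exists_sustained_pebbles hh (g.Pebbled O₁) (g.Queried O₁)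
    (fun t u w => g.pebbled_of_queried O₁) (fun t v => g.pebbled_or_queried_of_pebbled_succ O₁)
    (hsmall 0 rfl (Nat.lt_ceil.2 (hR _)))
    (fun m hm => by
      have hv : cylinderVertex hh (2 * h κ - 1) m ∈ (cylinder (h κ)).sinks := by
        rw [mem_cylinder_sinks hh]
        simp [cylinderVertex]
      set v := cylinderVertex hh (2 * h κ - 1) m
      have hpy : (xs v, (cylinderSHF h ζ).hash κ (Sum.elim O₁ O₂) (xs v)) ∈ {p | p ∈ y} := by
        rw [hy]
        exact ⟨xs v, (hxs v hv).1, rfl⟩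
      obtain ⟨s, -, hs⟩ := (g.mem_register O₁).1 (hreg ▸ hpy)
      refine g.exists_queried_of_read O₁ (s := s) ?_ hm
      change (if v ∈ (cylinder (h κ)).sinks then
        ((g.out O₁ s).find? fun p => p.1 = xs v).map fun p => p.2 ^^^ O₂ (xs v + 1)
        else none).isSome
      rw [if_pos hv, Option.isSome_map, List.find?_isSome]
      exact ⟨_, hs, by simp⟩)
  refine absurd hmem (not_lt.2 ?_)
  have hhT := g.not_halted_of_mem_batch O₁ hT
  calc (h κ : ℕ∞) = (Set.range fun s : Fin (h κ) => t₀ + s.val).encard := by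
        rw [← Set.image_univ, Function.Injective.encard_image, Set.encard_univ,
          ENat.card_eq_coe_fintype_card, Fintype.card_fin]
        intro s s' hs
        exact Fin.ext (Nat.add_left_cancel hs)
    _ ≤ _ := Set.encard_le_encard (by
        rintro _ ⟨s, rfl⟩
        have hs : (g.config O₁ (t₀ + s)).halted = false :=
          g.not_halted_of_le O₁ (by omega) hhT
        refine ⟨hs, ?_⟩
        by_contra hlt
        exact absurd (hpeb s s.2) (not_le.2 (hsmall _ hs (Nat.lt_ceil.2 (not_le.1 hlt)))))

/-- The success probability is at most the probability that some sink is never looked up plus the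
probability that some state of fewer than `Λ` words encodes `h κ` labels. -/
theorem card_succeeds_le {N : ℕ} (hh : 0 < h κ) (hκ : h κ ≤ 2 ^ κ)
    (hhalt : ∀ O ρ, (A.config O ρ (R O) N).halted = true)
    (hquery : ∀ O ρ i, (A.config O ρ (R O) i).halted = false →
      (A.query i ρ (A.config O ρ (R O) i).state).length ≤ N)
    (hR : ∀ O, ((R O).length : ℝ) < Λ * κ) :
    (Nat.card {ω : (CylinderQuery h κ → BitVec κ) × (Fin r → Bool) //
        Succeeds ζ A R X Λ ω.1 ω.2} : ℝ) ≤
      (h κ * Real.exp (-(X.card / (2 * h κ))) +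
        N * 2 ^ ⌈Λ * κ⌉₊ * (2 * h κ ^ 2 * (N * (N * 2 + 1)) * (N * N + 1)) ^ h κ /
          2 ^ (κ * h κ)) *
        Nat.card ((CylinderQuery h κ → BitVec κ) × (Fin r → Bool)) := by
  classical
  let Missed : (BitVec κ → BitVec κ) → Prop := fun f =>
    ∃ j < h κ, ∀ x ∈ X, (f x).toNat % h κ ≠ j
  let Ω := (CylinderQuery h κ → BitVec κ) × (Fin r → Bool)
  let e : Ω ≃ (LabelQuery (CylinderVertex (h κ)) 2 (BitVec κ) → BitVec κ) ×
      ((BitVec κ → BitVec κ) × (Fin r → Bool)) :=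
    ((Equiv.sumArrowEquivProdArrow _ _ _).prodCongr (Equiv.refl _)).trans (Equiv.prodAssoc _ _ _)
  let e' : Ω ≃ (BitVec κ → BitVec κ) ×
      ((LabelQuery (CylinderVertex (h κ)) 2 (BitVec κ) → BitVec κ) × (Fin r → Bool)) :=
    e.trans ⟨fun p => (p.2.1, p.1, p.2.2), fun p => (p.2.1, p.1, p.2.2), fun _ => rfl,
      fun _ => rfl⟩
  have hcardB : Fintype.card (BitVec κ) = 2 ^ κ := FinEnum.card_bitVec κ ▸ by
    rw [← FinEnum.card_eq_fintypeCard]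
  have h₁ : (Nat.card {ω : Ω // Missed fun x => ω.1 (Sum.inr x)} : ℝ) ≤
      h κ * Real.exp (-(X.card / (2 * h κ))) * Nat.card Ω :=
    card_le_of_forall_fiber e' _ _ fun _ => card_exists_residue_missed_le hh hκ X
  have h₂ : (Nat.card {ω : Ω // (¬ Missed fun x => ω.1 (Sum.inr x)) ∧
        Succeeds ζ A R X Λ ω.1 ω.2} : ℝ) ≤
      N * 2 ^ ⌈Λ * κ⌉₊ * (2 * h κ ^ 2 * (N * (N * 2 + 1)) * (N * N + 1)) ^ h κ /
          2 ^ (κ * h κ) * Nat.card Ω := by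
    refine card_le_of_forall_fiber e _ _ ?_
    rintro ⟨O₂, ρ⟩
    by_cases hO₂ : Missed O₂
    · have : IsEmpty {O₁ // (¬ Missed fun x => (e.symm (O₁, O₂, ρ)).1 (Sum.inr x)) ∧
          Succeeds ζ A R X Λ (e.symm (O₁, O₂, ρ)).1 (e.symm (O₁, O₂, ρ)).2} :=
        ⟨fun O₁ => O₁.2.1 hO₂⟩
      rw [Nat.card_of_isEmpty, Nat.cast_zero]
      positivity
    · have hlook : ∀ v : CylinderVertex (h κ), ∃ x, v ∈ (cylinder (h κ)).sinks → x ∈ X ∧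
          (cylinder (h κ)).sinks[(O₂ x).toNat % h κ]? = some v := by
        intro v
        by_cases hv : v ∈ (cylinder (h κ)).sinks
        · obtain ⟨j, hj, hjv⟩ := List.getElem_of_mem hv
          obtain ⟨x, hx, hxj⟩ : ∃ x ∈ X, (O₂ x).toNat % h κ = j := by
            by_contra! hcon
            exact hO₂ ⟨j, by rwa [length_cylinder_sinks hh] at hj, hcon⟩
          exact ⟨x, fun _ => ⟨hx, by rw [hxj, List.getElem?_eq_getElem hj, hjv]⟩⟩
        · exact ⟨0, fun hv' => absurd hv' hv⟩
      choose xs hxs using hlook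
      have hle := (cylinderGame ζ A R O₂ ρ xs).card_le N ⌈Λ * κ⌉₊ (h κ)
      have hV : Fintype.card (CylinderVertex (h κ)) = 2 * h κ ^ 2 := cylinderSize_eq (h κ)
      rw [hV, hcardB, ← pow_mul] at hle
      rw [div_mul_eq_mul_div, le_div_iff₀ (by positivity)]
      have hle' := (Nat.cast_le (α := ℝ)).2 hle
      push_cast at hle'
      refine le_trans ?_ hle'
      gcongr
      exact Nat.card_mono (Set.toFinite _) fun O₁ hO₁ =>
        hO₁.2.exists_pebbled hh hxs hhalt hquery hR
  have h₃ : Nat.card {ω : Ω // Succeeds ζ A R X Λ ω.1 ω.2} ≤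
      Nat.card {ω : Ω // Missed fun x => ω.1 (Sum.inr x)} +
      Nat.card {ω : Ω // (¬ Missed fun x => ω.1 (Sum.inr x)) ∧
        Succeeds ζ A R X Λ ω.1 ω.2} := by
    rw [← Nat.card_sum]
    refine Nat.card_le_card_of_injective (fun ω => if hω : Missed fun x => ω.1.1 (Sum.inr x) then
      Sum.inl ⟨ω.1, hω⟩ else Sum.inr ⟨ω.1, hω, ω.2⟩) fun ω ω' heq => ?_
    simp only at heq
    split_ifs at heq
    · have := Sum.inl_injective heq
      exact Subtype.ext (Subtype.mk.inj this)
    · have := Sum.inr_injective heq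
      exact Subtype.ext (Subtype.mk.inj this)
  have h₃' := (Nat.cast_le (α := ℝ)).2 h₃
  push_cast at h₃'
  rw [add_mul]
  exact h₃'.trans (add_le_add h₁ h₂)

end FixedParameter

/-! ### Asymptotics -/

theorem superpolynomialDecay_of_forall_eventually_le {f : ℕ → ℝ} (h0 : ∀ κ, 0 ≤ f κ)
    (hf : ∀ k : ℕ, ∀ᶠ κ : ℕ in atTop, f κ ≤ ((κ : ℝ) ^ k)⁻¹) :
    SuperpolynomialDecay atTop (fun κ : ℕ => (κ : ℝ)) f := by
  intro k
  have hinv : Tendsto (fun κ : ℕ => ((κ : ℝ))⁻¹) atTop (𝓝 0) := tendsto_inv_atTop_nhds_zero_nat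
  refine squeeze_zero' (Eventually.of_forall fun κ => mul_nonneg (by positivity) (h0 κ)) ?_ hinv
  filter_upwards [hf (k + 1), eventually_gt_atTop 0] with κ hκ hpos
  have hpos' : (0 : ℝ) < κ := Nat.cast_pos.2 hpos
  calc (κ : ℝ) ^ k * f κ ≤ (κ : ℝ) ^ k * ((κ : ℝ) ^ (k + 1))⁻¹ := by gcongr
    _ = (κ : ℝ)⁻¹ := by
        rw [pow_succ, mul_inv, ← mul_assoc, mul_inv_cancel₀ (by positivity), one_mul]

/-- The coupon collector bound is negligible once `q` exceeds every multiple of `h log κ`. -/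
theorem mul_exp_le_inv_pow {κ h q d k : ℕ} (hκ : 0 < κ) (hh : 0 < h) (hd : h ≤ κ ^ d)
    (hq : 2 * (k + d) * (h * Real.log κ) ≤ q) :
    h * Real.exp (-(q / (2 * h))) ≤ ((κ : ℝ) ^ k)⁻¹ := by
  have hκ' : (0 : ℝ) < κ := Nat.cast_pos.2 hκ
  have hh' : (0 : ℝ) < h := Nat.cast_pos.2 hh
  have hd' : (h : ℝ) ≤ (κ : ℝ) ^ d := by exact_mod_cast hd
  have hpow : ∀ m : ℕ, (κ : ℝ) ^ m = Real.exp (m * Real.log κ) := fun m => by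
    rw [Real.exp_nat_mul, Real.exp_log hκ']
  have hexp : (k + d) * Real.log κ ≤ q / (2 * h) := by
    rw [le_div_iff₀ (by positivity)]
    linarith
  calc h * Real.exp (-(q / (2 * h)))
      ≤ (κ : ℝ) ^ d * Real.exp (-((k + d) * Real.log κ)) := by gcongr
    _ = ((κ : ℝ) ^ k)⁻¹ := by
        rw [hpow, hpow, ← Real.exp_neg, ← Real.exp_add]
        congr 1
        ring

/-- The missing `h κ - T κ` bits outweigh the `O(h log κ)` bits of the hints: there are at most
`κ ^ c` times, at most `κ ^ (6 * c + 4)` hints for each of the `h` vertices, and rounding up the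
number of bits of the state costs another factor `κ`. -/
theorem hints_mul_states_le_inv_pow {κ h N c k : ℕ} {T : ℝ} (hκ : 2 ≤ κ) (hh : 0 < h)
    (hhc : h ≤ κ ^ c) (hN : N ≤ κ ^ c) (hT0 : 0 ≤ T)
    (hT : 2 * (7 * c + 5 + k) * (h * Real.log κ) ≤ (h - T) * κ) :
    (N * 2 ^ ⌈T * κ⌉₊ * (2 * h ^ 2 * (N * (N * 2 + 1)) * (N * N + 1)) ^ h / 2 ^ (κ * h) : ℝ) ≤
      ((κ : ℝ) ^ k)⁻¹ := by
  have hκ' : (0 : ℝ) < κ := Nat.cast_pos.2 (by omega)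
  have hκ2 : (2 : ℝ) ≤ κ := by exact_mod_cast hκ
  have hh1 : (1 : ℝ) ≤ h := by exact_mod_cast hh
  have hlog : 0 ≤ Real.log κ := Real.log_nonneg (by linarith)
  have hpow : ∀ m : ℕ, (κ : ℝ) ^ m = Real.exp (m * Real.log κ) := fun m => by
    rw [Real.exp_nat_mul, Real.exp_log hκ']
  have hN' : (N : ℝ) ≤ (κ : ℝ) ^ c := by exact_mod_cast hN
  have hM : 2 * (h : ℝ) ^ 2 * (N * (N * 2 + 1)) * (N * N + 1) ≤ (κ : ℝ) ^ (6 * c + 4) := by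
    have h1 : (1 : ℝ) ≤ (κ : ℝ) ^ c := one_le_pow₀ (by linarith)
    have hhc' : (h : ℝ) ≤ (κ : ℝ) ^ c := by exact_mod_cast hhc
    set y := (κ : ℝ) ^ c
    calc 2 * (h : ℝ) ^ 2 * (N * (N * 2 + 1)) * (N * N + 1)
        ≤ 2 * y ^ 2 * (y * (y * 2 + y)) * (y * y + y * y) := by
          have h11 : 1 ≤ y * y := by nlinarith
          gcongr
      _ = 12 * y ^ 6 := by ring
      _ ≤ (κ : ℝ) ^ 4 * y ^ 6 := by
          have : (2 : ℝ) ^ 4 ≤ (κ : ℝ) ^ 4 := by gcongr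
          gcongr
          linarith
      _ = (κ : ℝ) ^ (6 * c + 4) := by
          simp only [y]
          ring
  have h2 : (2 : ℝ) ^ ⌈T * κ⌉₊ / 2 ^ (κ * h) ≤
      κ * Real.exp (-((7 * c + 5 + k) * (h * Real.log κ))) := by
    have hceil := (Nat.ceil_lt_add_one (mul_nonneg hT0 hκ'.le)).le
    have hlog2 : (1 / 2 : ℝ) ≤ Real.log 2 := by linarith [Real.log_two_gt_d9]
    have hpow2 : ∀ m : ℕ, (2 : ℝ) ^ m = Real.exp (m * Real.log 2) := fun m => by
      rw [Real.exp_nat_mul, Real.exp_log two_pos]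
    calc (2 : ℝ) ^ ⌈T * κ⌉₊ / 2 ^ (κ * h)
        = Real.exp ((⌈T * κ⌉₊ - κ * h) * Real.log 2) := by
          rw [hpow2, hpow2, ← Real.exp_sub]
          push_cast
          congr 1
          ring
      _ ≤ Real.exp (Real.log 2 + -((7 * c + 5 + k) * (h * Real.log κ))) := by
          gcongr
          have h₁ : (⌈T * κ⌉₊ - κ * h : ℝ) * Real.log 2 ≤
              (1 - (h - T) * κ) * Real.log 2 :=
            mul_le_mul_of_nonneg_right (by linarith) (by linarith)
          have h₂ : 0 ≤ (7 * c + 5 + k) * (h * Real.log κ) := by positivity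
          nlinarith
      _ = 2 * Real.exp (-((7 * c + 5 + k) * (h * Real.log κ))) := by
          rw [Real.exp_add, Real.exp_log two_pos]
      _ ≤ _ := by gcongr
  calc (N * 2 ^ ⌈T * κ⌉₊ * (2 * h ^ 2 * (N * (N * 2 + 1)) * (N * N + 1)) ^ h / 2 ^ (κ * h) : ℝ)
      = N * (2 * h ^ 2 * (N * (N * 2 + 1)) * (N * N + 1)) ^ h *
          (2 ^ ⌈T * κ⌉₊ / 2 ^ (κ * h)) := by ring
    _ ≤ (κ : ℝ) ^ c * ((κ : ℝ) ^ (6 * c + 4)) ^ h *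
          (κ * Real.exp (-((7 * c + 5 + k) * (h * Real.log κ)))) := by gcongr
    _ = Real.exp ((c + 1 + (6 * c + 4) * h - (7 * c + 5 + k) * h) * Real.log κ) := by
        rw [← pow_mul, hpow, hpow]
        nth_rewrite 3 [← Real.exp_log hκ']
        rw [← Real.exp_add, ← Real.exp_add, ← Real.exp_add]
        push_cast
        congr 1
        ring
    _ ≤ Real.exp (-(k * Real.log κ)) := by
        have : (c + 1 + (6 * c + 4) * h - (7 * c + 5 + k) * h : ℝ) ≤ -k := by
          nlinarith [Nat.cast_nonneg (α := ℝ) c, Nat.cast_nonneg (α := ℝ) k]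
        gcongr
        nlinarith
    _ = ((κ : ℝ) ^ k)⁻¹ := by rw [hpow, Real.exp_neg]

theorem Polynomial.eval_le_eval_one_mul_pow (p : Polynomial ℕ) {x : ℕ} (hx : 1 ≤ x) :
    p.eval x ≤ p.eval 1 * x ^ p.natDegree := by
  rw [Polynomial.eval_eq_sum_range, Polynomial.eval_eq_sum_range, Finset.sum_mul]
  refine Finset.sum_le_sum fun i hi => ?_
  rw [one_pow, mul_one]
  exact Nat.mul_le_mul_left _
    (Nat.pow_le_pow_right hx (Nat.lt_succ_iff.1 (Finset.mem_range.1 hi)))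

theorem isTheta_natSqrt_half :
    (fun n : ℕ => (Nat.sqrt (n / 2) : ℝ)) =Θ[atTop] fun n : ℕ => √(n : ℝ) := by
  constructor
  · refine IsBigO.of_bound 1 (Eventually.of_forall fun n => ?_)
    rw [Real.norm_of_nonneg (Nat.cast_nonneg _), Real.norm_of_nonneg (Real.sqrt_nonneg _), one_mul]
    refine Real.le_sqrt_of_sq_le ?_
    have h₁ := Nat.sqrt_le' (n / 2)
    have : Nat.sqrt (n / 2) ^ 2 ≤ n := h₁.trans (Nat.div_le_self n 2)
    exact_mod_cast this
  · refine IsBigO.of_bound 3 ?_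
    filter_upwards [eventually_ge_atTop 2] with n hn
    rw [Real.norm_of_nonneg (Nat.cast_nonneg _), Real.norm_of_nonneg (Real.sqrt_nonneg _)]
    refine Real.sqrt_le_iff.2 ⟨by positivity, ?_⟩
    have h₁ := Nat.lt_succ_sqrt' (n / 2)
    have h₂ : 0 < Nat.sqrt (n / 2) := Nat.sqrt_pos.2 (by omega)
    have : n ≤ (3 * Nat.sqrt (n / 2)) ^ 2 := by
      have h₃ : n ≤ 2 * (n / 2) + 1 := by omega
      rw [Nat.succ_eq_add_one] at h₁
      nlinarith
    exact_mod_cast this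

theorem natSqrt_half_cylinderSize (h : ℕ) : Nat.sqrt (cylinderSize h / 2) = h := by
  rw [cylinderSize_eq, Nat.mul_div_cancel_left _ two_pos, Nat.sqrt_eq']

theorem exists_height_le_pow {h n : ℕ → ℕ} (hn : ∀ κ, n κ = cylinderSize (h κ))
    (hb : ∃ b : ℝ, ∀ᶠ κ : ℕ in atTop, (n κ : ℝ) ≤ (κ : ℝ) ^ b) :
    ∃ d : ℕ, ∀ᶠ κ in atTop, h κ ≤ κ ^ d := by
  obtain ⟨b, hb⟩ := hb
  refine ⟨⌈b⌉₊, ?_⟩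
  filter_upwards [hb, eventually_ge_atTop 1] with κ hκ h1
  have h1' : (1 : ℝ) ≤ κ := by exact_mod_cast h1
  have : (n κ : ℝ) ≤ (κ : ℝ) ^ ⌈b⌉₊ := by
    rw [← Real.rpow_natCast]
    exact hκ.trans (Real.rpow_le_rpow_of_exponent_le h1' (Nat.le_ceil b))
  have hnκ : n κ ≤ κ ^ ⌈b⌉₊ := by exact_mod_cast this
  rw [hn, cylinderSize_eq] at hnκ
  nlinarith

theorem height_le_sqrt {h n : ℕ → ℕ} (hn : ∀ κ, n κ = cylinderSize (h κ)) (κ : ℕ) : (h κ : ℝ) ≤ √(n κ : ℝ) := by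
  refine Real.le_sqrt_of_sq_le ?_
  rw [hn, cylinderSize_eq]
  push_cast
  nlinarith [sq_nonneg (h κ : ℝ)]

theorem eventually_lower_bounds {h n : ℕ → ℕ} (hn : ∀ κ, n κ = cylinderSize (h κ))
    {Λ : ℕ → ℝ} {a : ℝ}
    (hna : ∀ᶠ κ : ℕ in atTop, (κ : ℝ) ^ a ≤ n κ) (hΛ0 : ∀ κ, 0 ≤ Λ κ)
    (hΛ : Λ =Θ[atTop] fun κ => √(n κ : ℝ)) :
    ∃ C : ℝ, 0 < C ∧ ∀ᶠ κ in atTop, 0 < h κ ∧ h κ ≤ C * Λ κ ∧ (κ : ℝ) ^ (a / 2) ≤ C * Λ κ := by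
  obtain ⟨C, hC, hCΛ⟩ := hΛ.2.exists_pos
  refine ⟨C, hC, ?_⟩
  filter_upwards [hCΛ.bound, hna, eventually_gt_atTop 0] with κ h₁ h₂ h₃
  have h₃' : (0 : ℝ) < κ := Nat.cast_pos.2 h₃
  rw [Real.norm_of_nonneg (Real.sqrt_nonneg _), Real.norm_of_nonneg (hΛ0 κ)] at h₁
  refine ⟨?_, (height_le_sqrt hn κ).trans h₁, le_trans ?_ h₁⟩
  · rw [Nat.pos_iff_ne_zero]
    intro h0
    rw [hn, cylinderSize_eq, h0] at h₂
    have := Real.rpow_pos_of_pos h₃' a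
    norm_num at h₂
    linarith
  · rw [Real.sqrt_eq_rpow, div_eq_mul_one_div, Real.rpow_mul h₃'.le]
    exact Real.rpow_le_rpow (Real.rpow_nonneg h₃'.le _) h₂ (by norm_num)

/-- Since `Λ` is at least of order `h`, and `h` is at least a power of `κ`, the growth of `q` beyond
`Λ log Λ` is growth beyond `h log κ`. -/
theorem eventually_mul_height_mul_log_le {h n : ℕ → ℕ} (hn : ∀ κ, n κ = cylinderSize (h κ))
    {Λ : ℕ → ℝ} {a : ℝ} (ha : 0 < a)
    (hna : ∀ᶠ κ : ℕ in atTop, (κ : ℝ) ^ a ≤ n κ) (hΛ0 : ∀ κ, 0 ≤ Λ κ)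
    (hΛ : Λ =Θ[atTop] fun κ => √(n κ : ℝ)) {q : ℕ → ℕ}
    (hq : (fun κ => Λ κ * Real.log (Λ κ)) =o[atTop] fun κ => (q κ : ℝ)) (K : ℝ) (hK : 0 < K) :
    ∀ᶠ κ in atTop, K * (h κ * Real.log κ) ≤ q κ := by
  obtain ⟨C, hC, hbound⟩ := eventually_lower_bounds hn hna hΛ0 hΛ
  have hlog : Tendsto (fun κ : ℕ => Real.log κ) atTop atTop :=
    Real.tendsto_log_atTop.comp tendsto_natCast_atTop_atTop
  filter_upwards [hq.bound (show 0 < a / (4 * C * K) by positivity), hbound,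
    hlog.eventually_ge_atTop (4 / a * Real.log C), hlog.eventually_ge_atTop 0,
    eventually_gt_atTop 0] with κ h₁ ⟨_, h₂, h₃⟩ h₄ h₅ h₆
  have hκ : (0 : ℝ) < κ := Nat.cast_pos.2 h₆
  have hrpow := Real.rpow_pos_of_pos hκ (a / 2)
  have hΛpos : 0 < Λ κ := by
    by_contra hle
    nlinarith
  have h₇ : a / 4 * Real.log κ ≤ Real.log (Λ κ) := by
    have := Real.log_le_log hrpow h₃
    rw [Real.log_rpow hκ, Real.log_mul hC.ne' hΛpos.ne'] at this
    rw [div_mul_eq_mul_div, div_le_iff₀ ha] at h₄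
    linarith
  have h₈ : h κ * (a / 4 * Real.log κ) ≤ C * Λ κ * Real.log (Λ κ) := by gcongr
  rw [Real.norm_of_nonneg (Nat.cast_nonneg _)] at h₁
  have h₉ := (le_abs_self _).trans h₁
  rw [div_mul_eq_mul_div, le_div_iff₀ (by positivity)] at h₉
  have : a * (K * (h κ * Real.log κ)) ≤ a * q κ := by
    calc a * (K * (h κ * Real.log κ)) = 4 * K * (h κ * (a / 4 * Real.log κ)) := by ring
      _ ≤ 4 * K * (C * Λ κ * Real.log (Λ κ)) := by gcongr
      _ = Λ κ * Real.log (Λ κ) * (4 * C * K) := by ring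
      _ ≤ _ := h₉
  exact le_of_mul_le_mul_left this ha

theorem eventually_pow_le_two_pow (d : ℕ) : ∀ᶠ κ : ℕ in atTop, κ ^ d ≤ 2 ^ κ := by
  have := (isLittleO_pow_const_const_pow_of_one_lt (R := ℝ) d one_lt_two).bound one_pos
  filter_upwards [this] with κ hκ
  rw [Real.norm_of_nonneg (by positivity), Real.norm_of_nonneg (by positivity), one_mul] at hκ
  exact_mod_cast hκ

/-- The bound on the running time of the algorithm is polynomial in the security parameter. -/
theorem exists_eval_add_le_pow (p : Polynomial ℕ) {len : ℕ → ℕ} {d : ℕ}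
    (hlen : ∀ᶠ κ in atTop, len κ ≤ κ ^ (d + 1)) :
    ∃ c, d ≤ c ∧ ∀ᶠ κ in atTop, p.eval (κ + len κ) ≤ κ ^ c := by
  refine ⟨d + 1 + (d + 2) * p.natDegree, by omega, ?_⟩
  filter_upwards [hlen, eventually_ge_atTop 2, eventually_ge_atTop (p.eval 1)] with κ h₁ h₂ h₃
  have h₄ : κ + len κ ≤ κ ^ (d + 2) := by
    have h₅ : κ ≤ κ ^ (d + 1) := Nat.le_self_pow (by omega) κ
    calc κ + len κ ≤ κ ^ (d + 1) * 2 := by omega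
      _ ≤ κ ^ (d + 1) * κ := Nat.mul_le_mul_left _ h₂
      _ = κ ^ (d + 2) := by ring
  calc p.eval (κ + len κ) ≤ p.eval 1 * (κ + len κ) ^ p.natDegree :=
        p.eval_le_eval_one_mul_pow (by omega)
    _ ≤ κ ^ (d + 1) * (κ ^ (d + 2)) ^ p.natDegree :=
        Nat.mul_le_mul (h₃.trans (Nat.le_self_pow (by omega) κ)) (Nat.pow_le_pow_left h₄ _)
    _ = κ ^ (d + 1 + (d + 2) * p.natDegree) := by rw [← pow_mul, ← pow_add]

theorem mainTheorem4 :
    ∃ τ : ℕ → ℕ, ((fun n => (τ n : ℝ)) =Θ[atTop] fun n : ℕ => √(n : ℝ)) ∧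
      ∀ (h : ℕ → ℕ) (n : ℕ → ℕ) (_ : ∀ κ, n κ = cylinderSize (h κ))
        (_ : ∃ a : ℝ, 0 < a ∧ ∀ᶠ κ : ℕ in atTop, (κ : ℝ) ^ a ≤ n κ)
        (_ : ∃ b : ℝ, ∀ᶠ κ : ℕ in atTop, (n κ : ℝ) ≤ (κ : ℝ) ^ b)
        (ζ : ∀ κ, BitVec κ)
        (lam : ℝ) (_ : 0 ≤ lam)
        (Λ : ℕ → ℝ) (_ : ∀ κ, 0 ≤ Λ κ)
        (_ : Λ =Θ[atTop] fun κ => √(n κ : ℝ))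
        (_ : Tendsto (fun κ : ℕ => (h κ - (Λ κ - lam)) * κ / (h κ * Real.log κ)) atTop atTop)
        (q : ℕ → ℕ)
        (_ : (fun κ => Λ κ * Real.log (Λ κ)) =o[atTop] fun κ => (q κ : ℝ)),
        (cylinderSHF h ζ).IsHard (fun κ => Λ κ - lam) (fun κ => τ (n κ)) q := by
  refine ⟨fun n => Nat.sqrt (n / 2), isTheta_natSqrt_half, ?_⟩
  rintro h n hn ⟨a, ha, hna⟩ hnb ζ lam - Λ hΛ0 hΛ hgap q hq Δ hΔ R hR r A ⟨p, hp⟩ X hX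
  obtain ⟨d, hd⟩ := exists_height_le_pow hn hnb
  obtain ⟨C, hC, hbound⟩ := eventually_lower_bounds hn hna hΛ0 hΛ
  have hlog : Tendsto (fun κ : ℕ => Real.log κ) atTop atTop :=
    Real.tendsto_log_atTop.comp tendsto_natCast_atTop_atTop
  -- the memory threshold is eventually positive
  have hpos : ∀ᶠ κ in atTop, 0 < Λ κ - lam := by
    have hgrow : Tendsto (fun κ : ℕ => (κ : ℝ) ^ (a / 2)) atTop atTop :=
      (tendsto_rpow_atTop (by positivity)).comp tendsto_natCast_atTop_atTop
    filter_upwards [hbound, hgrow.eventually_gt_atTop (C * lam)] with κ h₁ h₂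
    have := lt_of_mul_lt_mul_left (h₂.trans_le h₁.2.2) hC.le
    linarith
  -- the threshold stays below `h` words by more than any multiple of `h log κ` bits
  have hgap' : ∀ K : ℝ, ∀ᶠ κ : ℕ in atTop,
      K * (h κ * Real.log κ) ≤ (h κ - (Λ κ - lam)) * κ := by
    intro K
    filter_upwards [hgap.eventually_ge_atTop K, hbound, hlog.eventually_gt_atTop 0]
      with κ h₁ h₂ h₃
    have : (0 : ℝ) < h κ := Nat.cast_pos.2 h₂.1
    rwa [le_div_iff₀ (by positivity)] at h₁
  -- the static string is smaller than the memory threshold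
  have hΔpos : ∀ᶠ κ in atTop, (0 : ℝ) < Δ κ := by
    filter_upwards [hΔ.bound one_pos, hlog.eventually_gt_atTop 0] with κ h₁ h₂
    rw [one_mul, Real.norm_of_nonneg h₂.le, Real.norm_of_nonneg (Nat.cast_nonneg _)] at h₁
    exact h₂.trans_le h₁
  have hshort : ∀ᶠ κ : ℕ in atTop,
      ((⌊(Λ κ - lam) * κ - Δ κ⌋₊ : ℕ) : ℝ) < (Λ κ - lam) * κ := by
    filter_upwards [hpos, hΔpos, eventually_gt_atTop 0] with κ h₁ h₂ h₃
    have : (0 : ℝ) < κ := Nat.cast_pos.2 h₃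
    rcases le_or_gt 0 ((Λ κ - lam) * κ - Δ κ) with h₄ | h₄
    · linarith [Nat.floor_le h₄]
    · rw [Nat.floor_of_nonpos h₄.le, Nat.cast_zero]
      positivity
  obtain ⟨c, hdc, hc⟩ := exists_eval_add_le_pow p
    (len := fun κ => ⌊(Λ κ - lam) * κ - Δ κ⌋₊) (d := d) (by
      filter_upwards [hshort, hgap' 0, hd] with κ h₁ h₂ h₃
      have h₄ : ((⌊(Λ κ - lam) * κ - Δ κ⌋₊ : ℕ) : ℝ) ≤ ((h κ * κ : ℕ) : ℝ) := by
        push_cast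
        linarith
      exact (Nat.cast_le.1 h₄).trans (Nat.mul_le_mul_right _ h₃))
  refine superpolynomialDecay_of_forall_eventually_le (fun κ => by positivity) fun k => ?_
  filter_upwards [hpos, hgap' (2 * (7 * c + 5 + (k + 1 : ℕ))), hshort, hc, hd, hbound,
    eventually_mul_height_mul_log_le hn ha hna hΛ0 hΛ hq (2 * ((k + 1 : ℕ) + d)) (by positivity),
    eventually_pow_le_two_pow d, eventually_ge_atTop 2, hR, hX]
    with κ hpos hgap hshort hN hd hbound hq h2pow hκ hR hX
  have hh := hbound.1
  have hκ' : (2 : ℝ) ≤ κ := by exact_mod_cast hκ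
  have hle := card_succeeds_le (ζ := ζ) (A := A κ) (R := R κ) (X := X κ) (Λ := Λ κ - lam)
    (N := p.eval (κ + ⌊(Λ κ - lam) * κ - Δ κ⌋₊)) hh (hd.trans h2pow)
    (fun O ρ => by rw [← hR O]; exact (hp κ O ρ (R κ O)).1)
    (fun O ρ => by rw [← hR O]; exact (hp κ O ρ (R κ O)).2)
    (fun O => by rw [hR O]; exact hshort)
  have hτ : Nat.sqrt (n κ / 2) = h κ := by rw [hn, natSqrt_half_cylinderSize]
  simp only [hτ]
  have hcard : (0 : ℝ) < Nat.card ((CylinderQuery h κ → BitVec κ) × (Fin (r κ) → Bool)) :=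
    Nat.cast_pos.2 Nat.card_pos
  refine (div_le_iff₀ hcard).2 (hle.trans (mul_le_mul_of_nonneg_right ?_ hcard.le))
  -- each of the two terms is at most `κ ^ (-(k + 1))`, and `2 ≤ κ`
  have h₁ := mul_exp_le_inv_pow (k := k + 1) (by omega) hh hd hq
  have h₂ := hints_mul_states_le_inv_pow (k := k + 1) hκ hh
    (hd.trans (Nat.pow_le_pow_right (by omega) hdc)) hN hpos.le hgap
  rw [hX]
  calc _ ≤ ((κ : ℝ) ^ (k + 1))⁻¹ + ((κ : ℝ) ^ (k + 1))⁻¹ := add_le_add h₁ h₂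
    _ = ((κ : ℝ) ^ k)⁻¹ * (2 * (κ : ℝ)⁻¹) := by rw [pow_succ, mul_inv]; ring
    _ ≤ ((κ : ℝ) ^ k)⁻¹ * 1 := by
        gcongr
        rw [← div_eq_mul_inv, div_le_one₀ (by linarith)]
        exact hκ'
    _ = _ := mul_one _
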